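/- Let $F_i(x)=a_i x+b_i$ $(1\le i\le A)$ and $G_j(x)=a'_j x+b'_j$ $(1\le j\le B)$ be two finite families of affine contractions of $\mathbb{R}$, with $A,B\ge 1$ and $0<|a_i|,|a'_j|<1$. Let $C_\lambda$ and $C_\gamma$ be their attractors, that is, the unique nonempty compact sets satisfying $C_\lambda=\bigcup_i F_i(C_\lambda)$ and $C_\gamma=\bigcup_j G_j(C_\gamma)$. Let $d_\lambda$ and $d_\gamma$ be the similarity dimensions, that is, the real numbers determined by $\sum_i |a_i|^{d_\lambda}=1$ and $\sum_j |a'_j|^{d_\gamma}=1$. For $\theta\in\mathbb{R}$ let $\Pi_\theta$ be the orthogonal projection of the Euclidean plane $\mathbb{R}^2$ onto the line through the origin that makes the angle $\theta$ with the positive $x$-axis, and let $\mathcal{IP}$ be the set of all $\theta\in\mathbb{R}$ for which $\Pi_\theta$ is not one-to-one on $C_\lambda\times C_\gamma$. Then $$\mathcal{H}^{d_\lambda+d_\gamma}\bigl(\Pi_\theta(C_\lambda\times C_\gamma)\bigr)=0\qquad\text{for Lebesgue-almost every }\theta\in\mathcal{IP},$$ where $\mathcal{H}^{s}$ denotes $s$-dimensional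 Hausdorff measure. -/

import Mathlib

open MeasureTheory
open scoped MeasureTheory

/-- A finite system of affine contractions `F_i(x) = a_i x + b_i` of the real line, with
`0 < |a_i| < 1`. The slope is `a_i = O_i λ_i` with orientation `O_i = ±1` and contraction
rate `λ_i = |a_i|`. -/
structure AffineIFS (n : ℕ) where
  slope : Fin n → ℝ
  shift : Fin n → ℝ
  slope_ne_zero : ∀ i, slope i ≠ 0
  abs_slope_lt_one : ∀ i, |slope i| < 1

namespace AffineIFS

variable {n : ℕ}

/-- The `i`-th map of the system. -/
def map (F : AffineIFS n) (i : Fin n) (x : ℝ) : ℝ := F.slope i * x + F.shift i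

/-- The contraction rate of the `i`-th map. -/
def rate (F : AffineIFS n) (i : Fin n) : ℝ := |F.slope i|

/-- `C` is the attractor of the system: the nonempty compact set with `C = ⋃ i, F_i(C)`. -/
def IsAttractor (F : AffineIFS n) (C : Set ℝ) : Prop :=
  C.Nonempty ∧ IsCompact C ∧ C = ⋃ i, F.map i '' C

/-- `d` is the similarity dimension of the system: the real number with `∑ λ_i ^ d = 1`. -/
def IsSimilarityDim (F : AffineIFS n) (d : ℝ) : Prop :=
  ∑ i, F.rate i ^ d = 1

end AffineIFS

/-- The product `A × B` as a subset of the Euclidean plane. -/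
def planeProd (A B : Set ℝ) : Set (EuclideanSpace ℝ (Fin 2)) :=
  {p | p 0 ∈ A ∧ p 1 ∈ B}

/-- The line through the origin making the angle `θ` with the positive `x`-axis. -/
def angleLine (θ : ℝ) : Submodule ℝ (EuclideanSpace ℝ (Fin 2)) :=
  Submodule.span ℝ {!₂[Real.cos θ, Real.sin θ]}

/-- The orthogonal projection of the Euclidean plane onto `angleLine θ`. -/
noncomputable def angleProj (θ : ℝ) (p : EuclideanSpace ℝ (Fin 2)) : EuclideanSpace ℝ (Fin 2) :=
  (angleLine θ).starProjection p

/-- The intersection parameters of `E`: angles whose projection is not one-to-one on `E`. -/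
def intersectionParams (E : Set (EuclideanSpace ℝ (Fin 2))) : Set ℝ :=
  {θ | ¬ Set.InjOn (angleProj θ) E}

section WordSum

variable {α : Type*}

/-- Two words that first agree and then differ in a letter. -/
def Diverge (U U' : List α) : Prop :=
  ∃ P i j Q Q', i ≠ j ∧ U = P ++ i :: Q ∧ U' = P ++ j :: Q'

theorem Diverge.append {U U' : List α} (h : Diverge U U') (w w' : List α) :
    Diverge (U ++ w) (U' ++ w') := by
  obtain ⟨P, i, j, Q, Q', hij, rfl, rfl⟩ := h
  exact ⟨P, i, j, Q ++ w, Q' ++ w', hij, by simp, by simp⟩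

theorem diverge_of_not_prefix : ∀ {U U' : List α}, ¬ U <+: U' → ¬ U' <+: U → Diverge U U'
  | [], _, h, _ => absurd (List.nil_prefix) h
  | _ :: _, [], _, h => absurd (List.nil_prefix) h
  | i :: U, j :: U', h, h' => by
    by_cases hij : i = j
    · subst hij
      obtain ⟨P, k, l, Q, Q', hkl, rfl, rfl⟩ := diverge_of_not_prefix (U := U) (U' := U')
        (fun hp => h (by simpa using hp)) (fun hp => h' (by simpa using hp))
      exact ⟨i :: P, k, l, Q, Q', hkl, rfl, rfl⟩
    · exact ⟨[], i, j, U, U', hij, rfl, rfl⟩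

variable [Fintype α]

/-- The sum of `f` over the words of length `m`, weighted by the products of the letter
weights `p`. -/
def wordSum (p : α → ℝ) : ℕ → (List α → ℝ) → ℝ
  | 0, f => f []
  | m + 1, f => ∑ i, p i * wordSum p m (fun w => f (i :: w))

variable {p : α → ℝ}

theorem wordSum_mono (hp : ∀ i, 0 ≤ p i) {m : ℕ} {f g : List α → ℝ} (h : ∀ u, f u ≤ g u) :
    wordSum p m f ≤ wordSum p m g := by
  induction m generalizing f g with
  | zero => exact h _
  | succ m ih =>
    exact Finset.sum_le_sum fun i _ => mul_le_mul_of_nonneg_left (ih fun u => h _) (hp i)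

theorem wordSum_affine (hp1 : ∑ i, p i = 1) (m : ℕ) (f : List α → ℝ) (a b : ℝ) :
    wordSum p m (fun u => a + b * f u) = a + b * wordSum p m f := by
  induction m generalizing f with
  | zero => rfl
  | succ m ih =>
    simp only [wordSum, ih, mul_add, Finset.sum_add_distrib, ← Finset.sum_mul, hp1, one_mul,
      Finset.mul_sum]
    congr 1
    exact Finset.sum_congr rfl fun i _ => by ring

theorem wordSum_const (hp1 : ∑ i, p i = 1) (m : ℕ) (c : ℝ) :
    wordSum p m (fun _ => c) = c := by
  simpa using wordSum_affine hp1 m (fun _ => 0) c 0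

theorem wordSum_nonneg (hp : ∀ i, 0 ≤ p i) {m : ℕ} {f : List α → ℝ} (h : ∀ u, 0 ≤ f u) :
    0 ≤ wordSum p m f := by
  induction m generalizing f with
  | zero => exact h _
  | succ m ih => exact Finset.sum_nonneg fun i _ => mul_nonneg (hp i) (ih fun u => h _)

theorem le_wordSum_append (hp : ∀ i, 0 ≤ p i) (w : List α) (m : ℕ) {f : List α → ℝ}
    (h : ∀ u, 0 ≤ f u) :
    (w.map p).prod * wordSum p m (fun u => f (w ++ u)) ≤ wordSum p (w.length + m) f := by
  induction w generalizing f with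
  | nil => simp
  | cons i w ih =>
    have e : (i :: w).length + m = (w.length + m) + 1 := by simp; omega
    rw [e, wordSum, List.map_cons, List.prod_cons, mul_assoc]
    refine (mul_le_mul_of_nonneg_left (ih (f := fun u => f (i :: u)) fun u => h _) (hp i)).trans ?_
    exact Finset.single_le_sum
      (f := fun i => p i * wordSum p (w.length + m) (fun u => f (i :: u)))
      (fun j _ => mul_nonneg (hp j) (wordSum_nonneg hp fun u => h _)) (Finset.mem_univ i)

theorem wordSum_le_succ (hp : ∀ i, 0 ≤ p i) (hp1 : ∑ i, p i = 1) {f : List α → ℝ}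
    (h : ∀ u i, f u ≤ f (u ++ [i])) (m : ℕ) : wordSum p m f ≤ wordSum p (m + 1) f := by
  induction m generalizing f with
  | zero =>
    calc f [] = ∑ i, p i * f [] := by rw [← Finset.sum_mul, hp1, one_mul]
      _ ≤ ∑ i, p i * f [i] :=
        Finset.sum_le_sum fun i _ => mul_le_mul_of_nonneg_left (h [] i) (hp i)
  | succ m ih =>
    exact Finset.sum_le_sum fun i _ => mul_le_mul_of_nonneg_left
      (ih (f := fun u => f (i :: u)) fun u j => h (i :: u) j) (hp i)

theorem monotone_wordSum (hp : ∀ i, 0 ≤ p i) (hp1 : ∑ i, p i = 1) {f : List α → ℝ}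
    (h : ∀ u i, f u ≤ f (u ++ [i])) : Monotone fun m => wordSum p m f :=
  monotone_nat_of_le_succ (wordSum_le_succ hp hp1 h)

theorem Diverge.add_le_wordSum (hp : ∀ i, 0 ≤ p i) (hp1 : ∑ i, p i = 1) {f : List α → ℝ}
    (h0 : ∀ u, 0 ≤ f u) (h : ∀ u i, f u ≤ f (u ++ [i])) {U U' : List α} (hU : Diverge U U')
    (m : ℕ) : ∃ M, (U.map p).prod * wordSum p m (fun u => f (U ++ u)) +
      (U'.map p).prod * wordSum p m (fun u => f (U' ++ u)) ≤ wordSum p M f := by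
  obtain ⟨P, i, j, Q, Q', hij, rfl, rfl⟩ := hU
  induction P generalizing f with
  | nil =>
    classical
    refine ⟨(max Q.length Q'.length + m) + 1, ?_⟩
    have key : ∀ (k : α) (q : List α), q.length ≤ max Q.length Q'.length →
        ((k :: q).map p).prod * wordSum p m (fun u => f (k :: q ++ u)) ≤
        p k * wordSum p (max Q.length Q'.length + m) (fun u => f (k :: u)) := by
      intro k q hq
      rw [List.map_cons, List.prod_cons, mul_assoc]
      refine mul_le_mul_of_nonneg_left ?_ (hp k)
      refine (le_wordSum_append hp q m (f := fun u => f (k :: u)) fun u => h0 _).trans ?_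
      exact monotone_wordSum hp hp1 (f := fun u => f (k :: u)) (fun u i => h (k :: u) i)
        (by omega)
    refine (add_le_add (key i Q (le_max_left _ _)) (key j Q' (le_max_right _ _))).trans ?_
    rw [← Finset.sum_pair
      (f := fun k => p k * wordSum p (max Q.length Q'.length + m) (fun u => f (k :: u))) hij]
    exact Finset.sum_le_sum_of_subset_of_nonneg (Finset.subset_univ _)
      fun k _ _ => mul_nonneg (hp k) (wordSum_nonneg hp fun u => h0 _)
  | cons k P ih =>
    obtain ⟨M, hM⟩ := ih (f := fun u => f (k :: u)) (fun u => h0 _) (fun u i => h (k :: u) i)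
    refine ⟨M + 1, ?_⟩
    refine le_trans (le_of_eq ?_) ((mul_le_mul_of_nonneg_left hM (hp k)).trans
      (Finset.single_le_sum (f := fun k => p k * wordSum p M (fun u => f (k :: u)))
        (fun j _ => mul_nonneg (hp j) (wordSum_nonneg hp fun u => h0 _)) (Finset.mem_univ k)))
    simp only [List.cons_append, List.map_cons, List.prod_cons]
    ring

theorem le_wordSum_of_subharmonic (hp : ∀ i, 0 ≤ p i) {g : List α → ℝ}
    (h : ∀ u, g u ≤ ∑ i, p i * g (u ++ [i])) (m : ℕ) (u : List α) :
    g u ≤ wordSum p m (fun w => g (u ++ w)) := by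
  induction m generalizing u with
  | zero => simp [wordSum]
  | succ m ih =>
    refine (h u).trans (Finset.sum_le_sum fun i _ => mul_le_mul_of_nonneg_left ?_ (hp i))
    simpa using ih (u ++ [i])

end WordSum

namespace AffineIFS

variable {n : ℕ} (F : AffineIFS n)

/-- The slope of the composition along a word. -/
def wslope (u : List (Fin n)) : ℝ := (u.map F.slope).prod

/-- The constant term of the composition along a word. -/
def wshift : List (Fin n) → ℝ
  | [] => 0
  | i :: u => F.slope i * wshift u + F.shift i

/-- The composition `F_{u_1} ∘ ⋯ ∘ F_{u_m}` along a word. -/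
def wmap (u : List (Fin n)) (x : ℝ) : ℝ := F.wslope u * x + F.wshift u

@[simp] theorem wslope_nil : F.wslope [] = 1 := rfl

@[simp] theorem wslope_cons (i : Fin n) (u : List (Fin n)) :
    F.wslope (i :: u) = F.slope i * F.wslope u := by simp [wslope]

theorem wslope_append (u v : List (Fin n)) : F.wslope (u ++ v) = F.wslope u * F.wslope v := by
  simp [wslope]

theorem wshift_append (u v : List (Fin n)) : F.wshift (u ++ v) = F.wmap u (F.wshift v) := by
  induction u with
  | nil => simp [wmap, wshift]
  | cons i u ih => simp only [List.cons_append, wshift, ih, wmap, wslope_cons]; ring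

theorem wmap_append (u v : List (Fin n)) (x : ℝ) :
    F.wmap (u ++ v) x = F.wmap u (F.wmap v x) := by
  simp only [wmap, wslope_append, wshift_append]; ring

theorem wmap_singleton (i : Fin n) (x : ℝ) : F.wmap [i] x = F.map i x := by
  simp [wmap, map, wshift]

theorem wmap_nil (x : ℝ) : F.wmap [] x = x := by
  simp [wmap, wshift]

theorem wslope_ne_zero (u : List (Fin n)) : F.wslope u ≠ 0 := by
  induction u with
  | nil => simp
  | cons i u ih => simpa using ⟨F.slope_ne_zero i, ih⟩

theorem abs_wslope_pos (u : List (Fin n)) : 0 < |F.wslope u| := abs_pos.2 (F.wslope_ne_zero u)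

theorem rate_pos (i : Fin n) : 0 < F.rate i := abs_pos.2 (F.slope_ne_zero i)

theorem rate_lt_one (i : Fin n) : F.rate i < 1 := F.abs_slope_lt_one i

theorem prod_rate_rpow (d : ℝ) (u : List (Fin n)) :
    (u.map fun i => F.rate i ^ d).prod = |F.wslope u| ^ d := by
  induction u with
  | nil => simp
  | cons i u ih =>
    rw [List.map_cons, List.prod_cons, ih, wslope_cons, abs_mul,
      Real.mul_rpow (abs_nonneg _) (abs_nonneg _), rate]

theorem rate_rpow_nonneg (d : ℝ) (i : Fin n) : 0 ≤ F.rate i ^ d :=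
  Real.rpow_nonneg (F.rate_pos i).le _

variable {F} {C : Set ℝ}

theorem IsAttractor.map_mem (h : F.IsAttractor C) (i : Fin n) {x : ℝ} (hx : x ∈ C) :
    F.map i x ∈ C := by
  rw [h.2.2]; exact Set.mem_iUnion.2 ⟨i, x, hx, rfl⟩

theorem IsAttractor.exists_map_eq (h : F.IsAttractor C) {x : ℝ} (hx : x ∈ C) :
    ∃ i, ∃ y ∈ C, F.map i y = x := by
  rw [h.2.2] at hx; simpa using hx

theorem IsAttractor.wmap_mem (h : F.IsAttractor C) (u : List (Fin n)) {x : ℝ} (hx : x ∈ C) :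
    F.wmap u x ∈ C := by
  induction u with
  | nil => simpa [wmap_nil]
  | cons i u ih =>
    have : F.wmap (i :: u) x = F.map i (F.wmap u x) := by
      rw [← wmap_singleton, ← wmap_append]; rfl
    rw [this]; exact h.map_mem i ih

theorem IsAttractor.nonempty_index (h : F.IsAttractor C) : Nonempty (Fin n) := by
  obtain ⟨x, hx⟩ := h.1
  exact ⟨(h.exists_map_eq hx).choose⟩

theorem IsSimilarityDim.nonneg [Nonempty (Fin n)] {d : ℝ} (h : F.IsSimilarityDim d) : 0 ≤ d := by
  by_contra! hd
  have i : Fin n := Classical.arbitrary _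
  have h1 : 1 < F.rate i ^ d := Real.one_lt_rpow_of_pos_of_lt_one_of_neg (F.rate_pos i)
    (F.rate_lt_one i) hd
  have h2 : F.rate i ^ d ≤ ∑ i, F.rate i ^ d :=
    Finset.single_le_sum (f := fun i => F.rate i ^ d) (fun j _ => F.rate_rpow_nonneg d j)
      (Finset.mem_univ i)
  rw [h] at h2
  linarith

variable (F) in
theorem exists_rate_bounds [Nonempty (Fin n)] :
    ∃ c ρ : ℝ, 0 < c ∧ ρ < 1 ∧ ∀ i, c ≤ F.rate i ∧ F.rate i ≤ ρ := by
  obtain ⟨i, hi⟩ := Finite.exists_min F.rate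
  obtain ⟨j, hj⟩ := Finite.exists_max F.rate
  exact ⟨F.rate i, F.rate j, F.rate_pos i, F.rate_lt_one j, fun k => ⟨hi k, hj k⟩⟩

/-- Every point of the attractor lies in a cylinder of any prescribed size. -/
theorem IsAttractor.exists_word (h : F.IsAttractor C) {c ρ : ℝ} (hc : 0 < c) (hρ : ρ < 1)
    (hcρ : ∀ i, c ≤ F.rate i ∧ F.rate i ≤ ρ) {x : ℝ} (hx : x ∈ C) {r : ℝ} (hr : 0 < r)
    (hr1 : r ≤ 1) : ∃ u, x ∈ F.wmap u '' C ∧ c * r ≤ |F.wslope u| ∧ |F.wslope u| ≤ r := by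
  have := h.nonempty_index
  have i0 : Fin n := Classical.arbitrary _
  have hρ0 : 0 ≤ ρ := ((F.rate_pos i0).le.trans (hcρ i0).2)
  have hc1 : c ≤ 1 := ((hcρ i0).1.trans (F.rate_lt_one i0).le)
  have key : ∀ k : ℕ, ∃ u, x ∈ F.wmap u '' C ∧ c * r ≤ |F.wslope u| ∧
      (|F.wslope u| ≤ r ∨ |F.wslope u| ≤ ρ ^ k) := by
    intro k
    induction k with
    | zero => exact ⟨[], ⟨x, hx, F.wmap_nil x⟩, by simp; nlinarith, Or.inr (by simp)⟩
    | succ k ih =>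
      obtain ⟨u, ⟨y, hy, hyx⟩, h1, h2⟩ := ih
      by_cases hur : |F.wslope u| ≤ r
      · exact ⟨u, ⟨y, hy, hyx⟩, h1, Or.inl hur⟩
      · replace h2 := h2.resolve_left hur
        push Not at hur
        obtain ⟨i, z, hz, hzy⟩ := h.exists_map_eq hy
        have e : |F.wslope (u ++ [i])| = |F.wslope u| * F.rate i := by
          simp [wslope_append, abs_mul, rate]
        refine ⟨u ++ [i], ⟨z, hz, ?_⟩, ?_, Or.inr ?_⟩
        · rw [wmap_append, wmap_singleton, hzy, hyx]
        · rw [e, mul_comm]; exact mul_le_mul hur.le (hcρ i).1 hc.le (abs_nonneg _)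
        · rw [e, pow_succ]; exact mul_le_mul h2 (hcρ i).2 (F.rate_pos i).le (by positivity)
  obtain ⟨k, hk⟩ := exists_pow_lt_of_lt_one hr hρ
  obtain ⟨u, h1, h2, h3⟩ := key k
  exact ⟨u, h1, h2, h3.elim id fun h => h.trans hk.le⟩

end AffineIFS

section Recurrence

open Filter Topology

/-- In a multiplicative submonoid of the reals with contracting and expanding elements, every
element has approximate inverses. -/
theorem Submonoid.exists_approx_inv {M : Submonoid ℝ} {g h : ℝ} (hg : g ∈ M) (hh : h ∈ M)
    (hg1 : 1 < |g|) (hh0 : h ≠ 0) (hh1 : |h| < 1) {m : ℝ} (hm : m ∈ M) (hm0 : m ≠ 0)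
    {ε : ℝ} (hε : 0 < ε) : ∃ p ∈ M, |m * p - 1| < ε := by
  have hhp : 0 < |h| := abs_pos.2 hh0
  let K : Set ℝ := {y | |h| ≤ |y| ∧ |y| ≤ 1}
  have hK : IsCompact K := by
    refine Metric.isCompact_of_isClosed_isBounded ?_ ?_
    · exact (isClosed_le continuous_const continuous_abs).inter
        (isClosed_le continuous_abs continuous_const)
    · refine (Metric.isBounded_closedBall (x := (0 : ℝ)) (r := 1)).subset fun y hy => ?_
      simpa using hy.2
  have step : ∀ y : K, ∃ p ∈ M, y.1 * (m * p) ∈ K := by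
    rintro ⟨y, hy1, hy2⟩
    have hym : 0 < |y * m| := abs_pos.2 (mul_ne_zero (abs_pos.1 (hhp.trans_le hy1)) hm0)
    obtain ⟨k, hk⟩ := pow_unbounded_of_one_lt (|y * m|⁻¹) hg1
    have hx : 1 < |y * m * g ^ k| := by
      rw [abs_mul, abs_pow, mul_comm]
      rwa [inv_lt_iff_one_lt_mul₀ hym] at hk
    obtain ⟨n, hn1, hn2⟩ := exists_nat_pow_near_of_lt_one (inv_pos.2 (zero_lt_one.trans hx))
      (inv_le_one_of_one_le₀ hx.le) hhp hh1
    have hx0 : (0:ℝ) < |y * m * g ^ k| := zero_lt_one.trans hx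
    refine ⟨g ^ k * h ^ (n + 1), M.mul_mem (M.pow_mem hg k) (M.pow_mem hh _), ?_⟩
    have e : |y * (m * (g ^ k * h ^ (n + 1)))| = |y * m * g ^ k| * |h| ^ (n + 1) := by
      rw [← abs_pow, ← abs_mul]; congr 1; ring
    constructor
    · change _ ≤ |y * (m * (g ^ k * h ^ (n + 1)))|
      rw [e, pow_succ, ← mul_assoc]
      have : 1 ≤ |y * m * g ^ k| * |h| ^ n := by
        rwa [inv_le_iff_one_le_mul₀' hx0] at hn2
      nlinarith
    · change |y * (m * (g ^ k * h ^ (n + 1)))| ≤ _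
      rw [e]
      have := (lt_inv_comm₀ (by positivity) hx0).1 hn1
      calc _ ≤ |y * m * g ^ k| * |y * m * g ^ k|⁻¹ := by gcongr
        _ = 1 := mul_inv_cancel₀ hx0.ne'
  choose q hqM hqK using step
  have h1K : (1 : ℝ) ∈ K := ⟨by simpa using hh1.le, by simp⟩
  let y : ℕ → K := fun n => Nat.rec ⟨1, h1K⟩ (fun _ z => ⟨z.1 * (m * q z), hqK z⟩) n
  have hy : ∀ n, (y (n + 1)).1 = (y n).1 * (m * q (y n)) := fun n => rfl
  have hyd : ∀ n k, ∃ p ∈ M, (y (n + (k + 1))).1 = (y n).1 * (m * p) := by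
    intro n k
    induction k with
    | zero => exact ⟨_, hqM _, hy n⟩
    | succ k ih =>
      obtain ⟨p, hp, e⟩ := ih
      refine ⟨p * (m * q (y (n + (k + 1)))), M.mul_mem hp (M.mul_mem hm (hqM _)), ?_⟩
      rw [← add_assoc, hy, e]; ring
  obtain ⟨a, ha, φ, hφ, hlim⟩ := hK.tendsto_subseq (x := fun n => (y n).1) fun n => (y n).2
  have ha0 : a ≠ 0 := abs_pos.1 (hhp.trans_le ha.1)
  have hq : Tendsto (fun k => (y (φ (k + 1))).1 / (y (φ k)).1) atTop (𝓝 1) := by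
    have := (hlim.comp (tendsto_add_atTop_nat 1)).div hlim ha0
    rwa [div_self ha0] at this
  obtain ⟨k, hk⟩ := ((Metric.tendsto_nhds.1 hq) ε hε).exists
  have hlt : φ k < φ (k + 1) := hφ (Nat.lt_succ_self k)
  obtain ⟨p, hp, e⟩ := hyd (φ k) (φ (k + 1) - φ k - 1)
  rw [show φ k + (φ (k + 1) - φ k - 1 + 1) = φ (k + 1) by omega] at e
  refine ⟨p, hp, ?_⟩
  have hy0 : (y (φ k)).1 ≠ 0 := abs_pos.1 (hhp.trans_le (y (φ k)).2.1)
  rwa [e, mul_div_cancel_left₀ _ hy0, Real.dist_eq] at hk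

/-- A bounded sequence in such a submonoid is returned close to `1` infinitely often by one
fixed element. -/
theorem Submonoid.exists_frequently_return {M : Submonoid ℝ} {g h : ℝ} (hg : g ∈ M)
    (hh : h ∈ M) (hg1 : 1 < |g|) (hh0 : h ≠ 0) (hh1 : |h| < 1) {x : ℕ → ℝ} (hx : ∀ n, x n ∈ M)
    {K : ℝ} (hK : 0 < K) (hx1 : ∀ n, K⁻¹ ≤ |x n|) (hx2 : ∀ n, |x n| ≤ K) {ε : ℝ} (hε : 0 < ε) :
    ∃ p ∈ M, ∃ᶠ n in atTop, |x n * p - 1| < ε := by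
  have hK' : 0 < K⁻¹ := inv_pos.2 hK
  obtain ⟨a, -, φ, hφ, hlim⟩ := (isCompact_closedBall (0 : ℝ) K).tendsto_subseq (x := x)
    fun n => by simpa using hx2 n
  have ha0 : a ≠ 0 := by
    have := ge_of_tendsto hlim.abs (Eventually.of_forall fun n => hx1 (φ n))
    exact abs_pos.1 (hK'.trans_le this)
  have hinv : Tendsto (fun n => (x (φ n))⁻¹) atTop (𝓝 a⁻¹) := hlim.inv₀ ha0
  have hone : Tendsto (fun n => |a * (x (φ n))⁻¹ - 1|) atTop (𝓝 0) := by
    have := ((hinv.const_mul a).sub_const 1).abs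
    simpa [mul_inv_cancel₀ ha0] using this
  obtain ⟨l, hl⟩ := (hone.eventually (gt_mem_nhds (show (0:ℝ) < ε / 4 by positivity))).exists
  have hxl : x (φ l) ≠ 0 := abs_pos.1 (hK'.trans_le (hx1 _))
  obtain ⟨p, hp, hpε⟩ := exists_approx_inv hg hh hg1 hh0 hh1 (hx (φ l)) hxl
    (show 0 < min 1 (ε / 4) by positivity)
  have hp1 := hpε.trans_le (min_le_left _ _)
  have hp2 := hpε.trans_le (min_le_right _ _)
  have hap : |a * p - 1| < ε := by
    have e : a * p - 1 = (a * (x (φ l))⁻¹ - 1) * (x (φ l) * p) + (x (φ l) * p - 1) := by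
      field_simp; ring
    have h2 : |x (φ l) * p| ≤ 2 := by
      have := abs_add_le (x (φ l) * p - 1) 1
      rw [sub_add_cancel, abs_one] at this
      linarith
    rw [e]
    refine (abs_add_le _ _).trans_lt ?_
    rw [abs_mul]
    nlinarith [abs_nonneg (a * (x (φ l))⁻¹ - 1), abs_nonneg (x (φ l) * p)]
  refine ⟨p, hp, ?_⟩
  have hev : ∀ᶠ n in atTop, |x (φ n) * p - 1| < ε :=
    ((hlim.mul_const p).sub_const 1).abs.eventually (gt_mem_nhds hap)
  exact hφ.tendsto_atTop.frequently hev.frequently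

end Recurrence

section Returns

open Filter Topology

variable {A B : ℕ} (F : AffineIFS A) (G : AffineIFS B)

/-- The submonoid of quotients of slopes of words. -/
def slopeQuotients : Submonoid ℝ where
  carrier := {x | ∃ u v, x = G.wslope v / F.wslope u}
  one_mem' := ⟨[], [], by simp⟩
  mul_mem' := by
    rintro _ _ ⟨u, v, rfl⟩ ⟨u', v', rfl⟩
    exact ⟨u ++ u', v ++ v', by
      rw [AffineIFS.wslope_append, AffineIFS.wslope_append, div_mul_div_comm]⟩

/-- Along a sequence of pairs of words of comparable sizes, one fixed pair of suffixes makes the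
quotient of the slopes close to `1` infinitely often. -/
theorem exists_frequently_suffix [Nonempty (Fin A)] [Nonempty (Fin B)]
    {u : ℕ → List (Fin A)} {v : ℕ → List (Fin B)} {K : ℝ} (hK : 0 < K)
    (h1 : ∀ n, K⁻¹ ≤ |G.wslope (v n) / F.wslope (u n)|)
    (h2 : ∀ n, |G.wslope (v n) / F.wslope (u n)| ≤ K) {ε : ℝ} (hε : 0 < ε) :
    ∃ w z, ∃ᶠ n in atTop, |G.wslope (v n ++ z) / F.wslope (u n ++ w) - 1| < ε := by
  have i : Fin A := Classical.arbitrary _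
  have j : Fin B := Classical.arbitrary _
  have hg : (F.slope i)⁻¹ ∈ slopeQuotients F G := ⟨[i], [], by simp⟩
  have hh : G.slope j ∈ slopeQuotients F G := ⟨[], [j], by simp⟩
  obtain ⟨p, ⟨w, z, rfl⟩, hp⟩ := Submonoid.exists_frequently_return hg hh
    (by rw [abs_inv]; exact (one_lt_inv₀ (F.rate_pos i)).2 (F.rate_lt_one i))
    (G.slope_ne_zero j) (G.abs_slope_lt_one j)
    (x := fun n => G.wslope (v n) / F.wslope (u n)) (fun n => ⟨_, _, rfl⟩) hK h1 h2 hε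
  refine ⟨w, z, hp.mono fun n hn => ?_⟩
  rwa [AffineIFS.wslope_append, AffineIFS.wslope_append, ← div_mul_div_comm]

end Returns

section ClosePairs

open Filter Topology

variable {A B : ℕ} {F : AffineIFS A} {G : AffineIFS B} {Cl Cg : Set ℝ}

/-- Two disjoint product cylinders whose projections in direction `t` have almost the same
position and scale, with scales in the two coordinates comparable up to the factor `K`. -/
def ClosePair (F : AffineIFS A) (G : AffineIFS B) (K ε t : ℝ) : Prop :=
  ∃ U V U' V', Diverge U U' ∧ |F.wslope U' / F.wslope U - 1| < ε ∧
    |G.wslope V' / G.wslope V - 1| < ε ∧ K⁻¹ ≤ |G.wslope V / F.wslope U| ∧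
    |G.wslope V / F.wslope U| ≤ K ∧
    |(F.wshift U + t * G.wshift V) - (F.wshift U' + t * G.wshift V')| < ε * |F.wslope U|

theorem isOpen_setOf_closePair (K ε : ℝ) : IsOpen {t | ClosePair F G K ε t} := by
  simp only [ClosePair, Set.ofPred_exists, Set.ofPred_and]
  refine isOpen_iUnion fun U => isOpen_iUnion fun V => isOpen_iUnion fun U' =>
    isOpen_iUnion fun V' => ?_
  refine isOpen_const.inter (isOpen_const.inter (isOpen_const.inter (isOpen_const.inter
    (isOpen_const.inter ?_))))
  exact isOpen_lt (by fun_prop) continuous_const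

theorem abs_div_bounds {a b c r : ℝ} (hc : 0 < c) (hr : 0 < r) (ha : c * r ≤ |a|) (ha' : |a| ≤ r)
    (hb : c * r ≤ |b|) (hb' : |b| ≤ r) : c ≤ |a / b| ∧ |a / b| ≤ c⁻¹ := by
  have hcr : 0 < c * r := mul_pos hc hr
  have hb0 : 0 < |b| := hcr.trans_le hb
  rw [abs_div]
  constructor
  · rw [le_div_iff₀ hb0]
    nlinarith
  · rw [div_le_iff₀ hb0, inv_mul_eq_div, le_div_iff₀ hc]
    nlinarith

namespace AffineIFS

theorem abs_sub_wshift_le {R : ℝ} (hR : ∀ x ∈ Cl, |x| ≤ R)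
    {u : List (Fin A)} {x : ℝ} (hx : x ∈ F.wmap u '' Cl) (w : List (Fin A)) :
    |x - F.wshift (u ++ w)| ≤ |F.wslope u| * (R + |F.wshift w|) := by
  obtain ⟨y, hy, rfl⟩ := hx
  have e : F.wmap u y - F.wshift (u ++ w) = F.wslope u * (y - F.wshift w) := by
    rw [wshift_append]; simp only [wmap]; ring
  rw [e, abs_mul]
  gcongr
  exact (abs_sub _ _).trans (by gcongr; exact hR y hy)

theorem IsAttractor.abs_sub_le_of_prefix (h : F.IsAttractor Cl) {R : ℝ} (hR : ∀ x ∈ Cl, |x| ≤ R)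
    {u u' : List (Fin A)} (hu : u <+: u') {x x' : ℝ} (hx : x ∈ F.wmap u '' Cl)
    (hx' : x' ∈ F.wmap u' '' Cl) : |x - x'| ≤ |F.wslope u| * (2 * R) := by
  obtain ⟨w, rfl⟩ := hu
  obtain ⟨y, hy, rfl⟩ := hx
  obtain ⟨y', hy', rfl⟩ := hx'
  rw [wmap_append, wmap, wmap, add_sub_add_right_eq_sub, ← mul_sub, abs_mul]
  gcongr
  refine (abs_sub _ _).trans ?_
  linarith [hR y hy, hR _ (h.wmap_mem w hy')]

theorem IsAttractor.diverge (h : F.IsAttractor Cl) {R : ℝ} (hR : ∀ x ∈ Cl, |x| ≤ R)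
    {u u' : List (Fin A)} {x x' r : ℝ} (hx : x ∈ F.wmap u '' Cl)
    (hx' : x' ∈ F.wmap u' '' Cl) (hu : |F.wslope u| ≤ r) (hu' : |F.wslope u'| ≤ r)
    (hr : r * (2 * R) < |x - x'|) : Diverge u u' := by
  have hR0 : 0 ≤ R := (abs_nonneg _).trans (hR _ h.1.some_mem)
  refine diverge_of_not_prefix (fun hp => ?_) (fun hp => ?_)
  · have := h.abs_sub_le_of_prefix hR hp hx hx'
    nlinarith
  · have := h.abs_sub_le_of_prefix hR hp hx' hx
    rw [abs_sub_comm] at this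
    nlinarith

/-- Two points of the attractor can be approximated, along a subsequence of scales, by cylinders
that become relatively close in scale after fixed words are appended. -/
theorem IsAttractor.exists_words_tendsto (h : F.IsAttractor Cl) {c ρ : ℝ} (hc : 0 < c)
    (hρ : ρ < 1) (hcρ : ∀ i, c ≤ F.rate i ∧ F.rate i ≤ ρ) {x x' : ℝ} (hx : x ∈ Cl) (hx' : x' ∈ Cl)
    {r : ℕ → ℝ} (hr : ∀ n, 0 < r n) (hr1 : ∀ n, r n ≤ 1) :
    ∃ u u' : ℕ → List (Fin A), ∃ a : ℝ, a ≠ 0 ∧ ∃ φ : ℕ → ℕ, StrictMono φ ∧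
      Tendsto (fun k => F.wslope (u (φ k)) / F.wslope (u' (φ k))) atTop (𝓝 a) ∧
      ∀ n, x ∈ F.wmap (u n) '' Cl ∧ x' ∈ F.wmap (u' n) '' Cl ∧
        c * r n ≤ |F.wslope (u n)| ∧ |F.wslope (u n)| ≤ r n ∧
        c * r n ≤ |F.wslope (u' n)| ∧ |F.wslope (u' n)| ≤ r n := by
  choose u hu using fun n => h.exists_word hc hρ hcρ hx (hr n) (hr1 n)
  choose u' hu' using fun n => h.exists_word hc hρ hcρ hx' (hr n) (hr1 n)
  have hq := fun n => abs_div_bounds hc (hr n) (hu n).2.1 (hu n).2.2 (hu' n).2.1 (hu' n).2.2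
  obtain ⟨a, -, φ, hφ, hlim⟩ := (isCompact_closedBall (0 : ℝ) c⁻¹).tendsto_subseq
    (x := fun n => F.wslope (u n) / F.wslope (u' n)) fun n => by
      rw [mem_closedBall_zero_iff, Real.norm_eq_abs]; exact (hq n).2
  refine ⟨u, u', a, ?_, φ, hφ, hlim, fun n => ⟨(hu n).1, (hu' n).1, (hu n).2.1, (hu n).2.2,
    (hu' n).2.1, (hu' n).2.2⟩⟩
  have := ge_of_tendsto hlim.abs (Eventually.of_forall fun n => (hq (φ n)).1)
  exact abs_pos.1 (hc.trans_le this)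

end AffineIFS

/-- Near a direction in which two points of the product project to the same point, at a sequence
of scales `r n → 0`, there are intervals of directions of length comparable to `r n` which
admit close pairs. -/
theorem exists_closePair_intervals (hCl : F.IsAttractor Cl) (hCg : G.IsAttractor Cg)
    {c ρ : ℝ} (hc : 0 < c) (hρ : ρ < 1) (hF : ∀ i, c ≤ F.rate i ∧ F.rate i ≤ ρ)
    (hG : ∀ i, c ≤ G.rate i ∧ G.rate i ≤ ρ) {t₀ x x' y y' : ℝ} (hx : x ∈ Cl) (hx' : x' ∈ Cl)
    (hy : y ∈ Cg) (hy' : y' ∈ Cg) (hxx : x ≠ x') (hyy : y ≠ y')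
    (he : x + t₀ * y = x' + t₀ * y') {ε : ℝ} (hε : 0 < ε) :
    ∃ κ D : ℝ, 0 < κ ∧ 0 < D ∧ ∃ t₁ r : ℕ → ℝ, Tendsto r atTop (𝓝[>] 0) ∧
      ∀ᶠ n in atTop, |t₁ n - t₀| ≤ D * r n ∧
        ∀ t, |t - t₁ n| ≤ κ * r n → ClosePair F G (c ^ 2)⁻¹ ε t := by
  obtain ⟨R, hR⟩ : ∃ R, ∀ x ∈ Cl ∪ Cg, |x| ≤ R :=
    (hCl.2.1.union hCg.2.1).isBounded.exists_norm_le
  have hRl : ∀ x ∈ Cl, |x| ≤ R := fun x hx => hR x (Or.inl hx)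
  have hRg : ∀ x ∈ Cg, |x| ≤ R := fun x hx => hR x (Or.inr hx)
  have hR0 : 0 ≤ R := (abs_nonneg _).trans (hRl x hx)
  obtain ⟨u, u', a, ha, φ, hφ, hlim, hu⟩ := hCl.exists_words_tendsto hc hρ hF hx hx'
    (r := fun n => (1 / 2 : ℝ) ^ n) (fun n => by positivity)
    (fun n => pow_le_one₀ (by norm_num) (by norm_num))
  obtain ⟨v, v', b, hb, ψ, hψ, hlim', hv⟩ := hCg.exists_words_tendsto hc hρ hG hy hy'
    (r := fun n => (1 / 2 : ℝ) ^ φ n) (fun n => by positivity)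
    (fun n => pow_le_one₀ (by norm_num) (by norm_num))
  let r : ℕ → ℝ := fun n => (1 / 2 : ℝ) ^ φ (ψ n)
  have hr0 : ∀ n, 0 < r n := fun n => by positivity
  have hr : Tendsto r atTop (𝓝 0) :=
    (tendsto_pow_atTop_nhds_zero_of_lt_one (by norm_num) (by norm_num)).comp
      (hφ.comp hψ).tendsto_atTop
  -- relabel along the subsequence
  obtain ⟨p, p', q, q', hP, hQ, hp, hq⟩ : ∃ (p p' : ℕ → List (Fin A)) (q q' : ℕ → List (Fin B)),
      Tendsto (fun k => F.wslope (p k) / F.wslope (p' k)) atTop (𝓝 a) ∧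
      Tendsto (fun k => G.wslope (q k) / G.wslope (q' k)) atTop (𝓝 b) ∧
      (∀ n, x ∈ F.wmap (p n) '' Cl ∧ x' ∈ F.wmap (p' n) '' Cl ∧
        c * r n ≤ |F.wslope (p n)| ∧ |F.wslope (p n)| ≤ r n ∧
        c * r n ≤ |F.wslope (p' n)| ∧ |F.wslope (p' n)| ≤ r n) ∧
      (∀ n, y ∈ G.wmap (q n) '' Cg ∧ y' ∈ G.wmap (q' n) '' Cg ∧
        c * r n ≤ |G.wslope (q n)| ∧ |G.wslope (q n)| ≤ r n ∧
        c * r n ≤ |G.wslope (q' n)| ∧ |G.wslope (q' n)| ≤ r n) :=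
    ⟨fun n => u (φ (ψ n)), fun n => u' (φ (ψ n)), fun n => v (ψ n), fun n => v' (ψ n),
      hlim.comp hψ.tendsto_atTop, hlim', fun n => hu _, fun n => hv _⟩
  have hret : ∀ {s : ℕ → ℝ} {a : ℝ}, a ≠ 0 → Tendsto s atTop (𝓝 a) →
      ∀ᶠ l in atTop, ∀ᶠ k in atTop, |s l / s k - 1| < ε := by
    intro s a ha hs
    have h1 : Tendsto (fun l => |s l / a - 1|) atTop (𝓝 0) := by
      have := ((hs.div_const a).sub_const 1).abs
      rwa [div_self ha, sub_self, abs_zero] at this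
    filter_upwards [h1.eventually (gt_mem_nhds hε)] with l hl
    exact (((tendsto_const_nhds (x := s l)).div hs ha).sub_const 1).abs.eventually
      (gt_mem_nhds hl)
  obtain ⟨l, hl1, hl2⟩ := ((hret ha hP).and (hret hb hQ)).exists
  let E : ℝ := R + |F.wshift (p l)| + |F.wshift (p' l)| + |G.wshift (q l)| + |G.wshift (q' l)|
  have hE0 : 0 ≤ E := by positivity
  let d : ℝ := |y - y'|
  have hd : 0 < d := abs_pos.2 (sub_ne_zero.2 hyy)
  let σ : ℝ := |F.wslope (p' l)|
  have hσ : 0 < σ := F.abs_wslope_pos _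
  refine ⟨ε * c * σ / (4 * d), (2 + 2 * |t₀|) * E * 2 / d + 1, by positivity, by positivity, ?_⟩
  let f₀ : ℕ → ℝ := fun k => F.wshift (p k ++ p' l) - F.wshift (p' k ++ p l)
  let f₁ : ℕ → ℝ := fun k => G.wshift (q k ++ q' l) - G.wshift (q' k ++ q l)
  refine ⟨fun k => - f₀ k / f₁ k, r, tendsto_nhdsWithin_iff.2 ⟨hr, Eventually.of_forall hr0⟩, ?_⟩
  have hsmall1 : ∀ᶠ k in atTop, r k * (2 * R) < |x - x'| :=
    (by simpa using hr.mul_const (2 * R) : Tendsto (fun k => r k * (2 * R)) atTop (𝓝 0)).eventually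
      (gt_mem_nhds (abs_pos.2 (sub_ne_zero.2 hxx)))
  have hsmall2 : ∀ᶠ k in atTop, r k * (2 * E) < d / 2 :=
    (by simpa using hr.mul_const (2 * E) : Tendsto (fun k => r k * (2 * E)) atTop (𝓝 0)).eventually
      (gt_mem_nhds (by positivity))
  filter_upwards [hl1, hl2, hsmall1, hsmall2] with k hk1 hk2 hk3 hk4
  obtain ⟨hp1, hp2, hp3, hp4, hp5, hp6⟩ := hp k
  obtain ⟨hq1, hq2, hq3, hq4, hq5, hq6⟩ := hq k
  obtain ⟨_, _, hp3', hp4', hp5', hp6'⟩ := hp l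
  obtain ⟨_, _, hq3', hq4', hq5', hq6'⟩ := hq l
  have b1 : |x - F.wshift (p k ++ p' l)| ≤ r k * E :=
    (AffineIFS.abs_sub_wshift_le hRl hp1 _).trans (mul_le_mul hp4 (by
      have := abs_nonneg (F.wshift (p l)); have := abs_nonneg (G.wshift (q l))
      have := abs_nonneg (G.wshift (q' l)); simp only [E]; linarith) (by positivity) (hr0 k).le)
  have b2 : |x' - F.wshift (p' k ++ p l)| ≤ r k * E :=
    (AffineIFS.abs_sub_wshift_le hRl hp2 _).trans (mul_le_mul hp6 (by
      have := abs_nonneg (F.wshift (p' l)); have := abs_nonneg (G.wshift (q l))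
      have := abs_nonneg (G.wshift (q' l)); simp only [E]; linarith) (by positivity) (hr0 k).le)
  have b3 : |y - G.wshift (q k ++ q' l)| ≤ r k * E :=
    (AffineIFS.abs_sub_wshift_le hRg hq1 _).trans (mul_le_mul hq4 (by
      have := abs_nonneg (F.wshift (p l)); have := abs_nonneg (G.wshift (q l))
      have := abs_nonneg (F.wshift (p' l)); simp only [E]; linarith) (by positivity) (hr0 k).le)
  have b4 : |y' - G.wshift (q' k ++ q l)| ≤ r k * E :=
    (AffineIFS.abs_sub_wshift_le hRg hq2 _).trans (mul_le_mul hq6 (by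
      have := abs_nonneg (F.wshift (p l)); have := abs_nonneg (G.wshift (q' l))
      have := abs_nonneg (F.wshift (p' l)); simp only [E]; linarith) (by positivity) (hr0 k).le)
  have hf1 : |f₁ k - (y - y')| ≤ r k * (2 * E) := by
    have e : f₁ k - (y - y') = -(y - G.wshift (q k ++ q' l)) + (y' - G.wshift (q' k ++ q l)) := by
      simp only [f₁]; ring
    rw [e]
    refine (abs_add_le _ _).trans ?_
    rw [abs_neg]; linarith
  have hf1l : d / 2 ≤ |f₁ k| := by
    have := abs_sub_abs_le_abs_sub (y - y') (f₁ k)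
    rw [abs_sub_comm (y - y')] at this
    change d - |f₁ k| ≤ _ at this
    linarith
  have hf1u : |f₁ k| ≤ 2 * d := by
    have := abs_sub_abs_le_abs_sub (f₁ k) (y - y')
    change |f₁ k| - d ≤ _ at this
    linarith
  have hf1p : 0 < |f₁ k| := (half_pos hd).trans_le hf1l
  have hf1n : f₁ k ≠ 0 := abs_pos.1 hf1p
  have hft : |f₀ k + t₀ * f₁ k| ≤ (2 + 2 * |t₀|) * E * r k := by
    have e : f₀ k + t₀ * f₁ k = (-(x - F.wshift (p k ++ p' l)) + (x' - F.wshift (p' k ++ p l))) +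
        t₀ * (-(y - G.wshift (q k ++ q' l)) + (y' - G.wshift (q' k ++ q l))) := by
      simp only [f₀, f₁]; linear_combination he
    rw [e]
    refine (abs_add_le _ _).trans ?_
    rw [abs_mul]
    have h1 := abs_add_le (-(x - F.wshift (p k ++ p' l))) (x' - F.wshift (p' k ++ p l))
    have h2 := abs_add_le (-(y - G.wshift (q k ++ q' l))) (y' - G.wshift (q' k ++ q l))
    rw [abs_neg] at h1 h2
    have h3 : |t₀| * |-(y - G.wshift (q k ++ q' l)) + (y' - G.wshift (q' k ++ q l))| ≤
        |t₀| * (r k * E + r k * E) := by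
      gcongr; linarith
    linarith
  constructor
  · have e : -f₀ k / f₁ k - t₀ = -(f₀ k + t₀ * f₁ k) / f₁ k := by field_simp; ring
    rw [e, abs_div, abs_neg, div_le_iff₀ hf1p]
    refine hft.trans ?_
    have h1 : (2 + 2 * |t₀|) * E * r k = (2 + 2 * |t₀|) * E * 2 / d * r k * (d / 2) := by
      field_simp
    rw [h1]
    refine mul_le_mul ?_ hf1l (by positivity) (by have := hr0 k; positivity)
    exact mul_le_mul_of_nonneg_right (by linarith) (hr0 k).le
  · intro t ht
    refine ⟨p k ++ p' l, q k ++ q' l, p' k ++ p l, q' k ++ q l,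
      (hCl.diverge hRl hp1 hp2 hp4 hp6 hk3).append _ _, ?_, ?_, ?_, ?_, ?_⟩
    · convert hk1 using 3
      rw [AffineIFS.wslope_append, AffineIFS.wslope_append]
      have := F.wslope_ne_zero (p k); have := F.wslope_ne_zero (p' k)
      have := F.wslope_ne_zero (p l); have := F.wslope_ne_zero (p' l)
      field_simp
    · convert hk2 using 3
      rw [AffineIFS.wslope_append, AffineIFS.wslope_append]
      have := G.wslope_ne_zero (q k); have := G.wslope_ne_zero (q' k)
      have := G.wslope_ne_zero (q l); have := G.wslope_ne_zero (q' l)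
      field_simp
    · rw [inv_inv, AffineIFS.wslope_append, AffineIFS.wslope_append, ← div_mul_div_comm, abs_mul,
        pow_two]
      exact mul_le_mul (abs_div_bounds hc (hr0 k) hq3 hq4 hp3 hp4).1
        (abs_div_bounds hc (hr0 l) hq5' hq6' hp5' hp6').1 hc.le (abs_nonneg _)
    · rw [AffineIFS.wslope_append, AffineIFS.wslope_append, ← div_mul_div_comm, abs_mul,
        pow_two, mul_inv]
      exact mul_le_mul (abs_div_bounds hc (hr0 k) hq3 hq4 hp3 hp4).2
        (abs_div_bounds hc (hr0 l) hq5' hq6' hp5' hp6').2 (abs_nonneg _) (by positivity)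
    · have e : (F.wshift (p k ++ p' l) + t * G.wshift (q k ++ q' l)) -
          (F.wshift (p' k ++ p l) + t * G.wshift (q' k ++ q l)) =
          f₁ k * (t - -f₀ k / f₁ k) := by
        have : f₁ k * (t - -f₀ k / f₁ k) = f₀ k + t * f₁ k := by field_simp; ring
        rw [this]; simp only [f₀, f₁]; ring
      rw [e, abs_mul, AffineIFS.wslope_append, abs_mul]
      change _ < ε * (_ * σ)
      calc |f₁ k| * |t - -f₀ k / f₁ k| ≤ 2 * d * (ε * c * σ / (4 * d) * r k) :=
            mul_le_mul hf1u ht (abs_nonneg _) (by positivity)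
        _ = ε * (c * r k * σ) / 2 := by field_simp; ring
        _ < ε * (c * r k * σ) := half_lt_self (by have := hr0 k; positivity)
        _ ≤ _ := by gcongr

/-- In almost every direction with a coincidence there are close pairs of every quality. -/
theorem ae_closePair (hCl : F.IsAttractor Cl) (hCg : G.IsAttractor Cg)
    {c ρ : ℝ} (hc : 0 < c) (hρ : ρ < 1) (hF : ∀ i, c ≤ F.rate i ∧ F.rate i ≤ ρ)
    (hG : ∀ i, c ≤ G.rate i ∧ G.rate i ≤ ρ) {ε : ℝ} (hε : 0 < ε) :
    ∀ᵐ t : ℝ, (∃ x ∈ Cl, ∃ x' ∈ Cl, ∃ y ∈ Cg, ∃ y' ∈ Cg, x ≠ x' ∧ y ≠ y' ∧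
      x + t * y = x' + t * y') → ClosePair F G (c ^ 2)⁻¹ ε t := by
  let S : Set ℝ := {t | ClosePair F G (c ^ 2)⁻¹ ε t}ᶜ
  have hS : MeasurableSet S := (isOpen_setOf_closePair _ _).measurableSet.compl
  have hden := ae_all_iff.2 fun N : ℕ =>
    IsUnifLocDoublingMeasure.ae_tendsto_measure_inter_div (volume : Measure ℝ) S N
  filter_upwards [(ae_restrict_iff' hS).1 hden] with t₀ ht₀
  rintro ⟨x, hx, x', hx', y, hy, y', hy', hxx, hyy, he⟩
  by_contra hbad
  obtain ⟨κ, D, hκ, hD, t₁, r, hr, hev⟩ :=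
    exists_closePair_intervals hCl hCg hc hρ hF hG hx hx' hy hy' hxx hyy he hε
  obtain ⟨N, hN⟩ := exists_nat_ge (D / κ)
  have hr' := tendsto_nhdsWithin_iff.1 hr
  have hlim := ht₀ hbad N (l := atTop) t₁ (fun n => κ * r n)
    (tendsto_nhdsWithin_iff.2 ⟨by simpa using hr'.1.const_mul κ,
      hr'.2.mono fun n hn => mul_pos hκ hn⟩)
    (by
      filter_upwards [hev, hr'.2] with n hn hn0
      have hn0 : 0 < r n := hn0
      rw [Metric.mem_closedBall, dist_comm, Real.dist_eq]
      refine hn.1.trans ?_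
      rw [div_le_iff₀ hκ] at hN
      nlinarith)
  have hzero : Tendsto (fun n => volume (S ∩ Metric.closedBall (t₁ n) (κ * r n)) /
      volume (Metric.closedBall (t₁ n) (κ * r n))) atTop (𝓝 0) := by
    refine tendsto_const_nhds.congr' ?_
    filter_upwards [hev] with n hn
    have : S ∩ Metric.closedBall (t₁ n) (κ * r n) = ∅ := by
      refine Set.eq_empty_of_forall_notMem fun t ht => ht.1 (hn.2 t ?_)
      simpa [Real.dist_eq] using ht.2
    simp [this]
  exact zero_ne_one (tendsto_nhds_unique hzero hlim)

end ClosePairs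

section Mass

open Filter Topology

variable {A B : ℕ} {F : AffineIFS A} {G : AffineIFS B} {Cl Cg : Set ℝ}

/-- The projection in direction `t` of the product cylinder of two words. -/
def projCyl (F : AffineIFS A) (G : AffineIFS B) (Cl Cg : Set ℝ) (t : ℝ)
    (u : List (Fin A)) (v : List (Fin B)) : Set ℝ :=
  {z | ∃ x ∈ Cl, ∃ y ∈ Cg, z = F.wmap u x + t * G.wmap v y}

open Classical in
/-- The total weight of the product cylinders of level `(m, n)` that project into `J`. -/
noncomputable def projMass (F : AffineIFS A) (G : AffineIFS B) (Cl Cg : Set ℝ) (dl dg t : ℝ)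
    (m n : ℕ) (J : Set ℝ) : ℝ :=
  wordSum (fun i => F.rate i ^ dl) m fun u => wordSum (fun j => G.rate j ^ dg) n fun v =>
    if projCyl F G Cl Cg t u v ⊆ J then 1 else 0

theorem projCyl_append_left (hCl : F.IsAttractor Cl) (t : ℝ) (u : List (Fin A))
    (v : List (Fin B)) :
    projCyl F G Cl Cg t u v = ⋃ i, projCyl F G Cl Cg t (u ++ [i]) v := by
  ext z
  simp only [projCyl, Set.mem_ofPred_eq, Set.mem_iUnion, AffineIFS.wmap_append,
    AffineIFS.wmap_singleton]
  constructor
  · rintro ⟨x, hx, y, hy, rfl⟩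
    obtain ⟨i, x', hx', rfl⟩ := hCl.exists_map_eq hx
    exact ⟨i, x', hx', y, hy, rfl⟩
  · rintro ⟨i, x, hx, y, hy, rfl⟩
    exact ⟨_, hCl.map_mem i hx, y, hy, rfl⟩

theorem projCyl_append_right (hCg : G.IsAttractor Cg) (t : ℝ) (u : List (Fin A))
    (v : List (Fin B)) :
    projCyl F G Cl Cg t u v = ⋃ j, projCyl F G Cl Cg t u (v ++ [j]) := by
  ext z
  simp only [projCyl, Set.mem_ofPred_eq, Set.mem_iUnion, AffineIFS.wmap_append,
    AffineIFS.wmap_singleton]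
  constructor
  · rintro ⟨x, hx, y, hy, rfl⟩
    obtain ⟨j, y', hy', rfl⟩ := hCg.exists_map_eq hy
    exact ⟨j, x, hx, y', hy', rfl⟩
  · rintro ⟨j, x, hx, y, hy, rfl⟩
    exact ⟨x, hx, _, hCg.map_mem j hy, rfl⟩

theorem projMass_le_one (hdl : F.IsSimilarityDim dl) (hdg : G.IsSimilarityDim dg) (t : ℝ)
    (m n : ℕ) (J : Set ℝ) : projMass F G Cl Cg dl dg t m n J ≤ 1 := by
  classical
  calc projMass F G Cl Cg dl dg t m n J
      ≤ wordSum (fun i => F.rate i ^ dl) m fun _ => 1 := by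
        refine wordSum_mono (F.rate_rpow_nonneg dl) fun u => ?_
        calc _ ≤ wordSum (fun j => G.rate j ^ dg) n fun _ => 1 :=
              wordSum_mono (G.rate_rpow_nonneg dg) fun v => by split_ifs <;> norm_num
          _ = 1 := wordSum_const hdg n 1
    _ = 1 := wordSum_const hdl m 1

theorem projMass_nonneg (dl dg t : ℝ) (m n : ℕ) (J : Set ℝ) :
    0 ≤ projMass F G Cl Cg dl dg t m n J :=
  wordSum_nonneg (F.rate_rpow_nonneg dl) fun _ =>
    wordSum_nonneg (G.rate_rpow_nonneg dg) fun _ => by split_ifs <;> norm_num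

/-- Two disjoint product cylinders both contribute to the mass of `J`. -/
theorem Diverge.add_le_projMass (hCl : F.IsAttractor Cl) (hCg : G.IsAttractor Cg)
    {dl dg : ℝ} (hdl : F.IsSimilarityDim dl) (hdg : G.IsSimilarityDim dg) {t : ℝ}
    {U U' : List (Fin A)} (hU : Diverge U U') {V V' : List (Fin B)} {I J : Set ℝ}
    (h : ∀ u v, projCyl F G Cl Cg t u v ⊆ I → projCyl F G Cl Cg t (U ++ u) (V ++ v) ⊆ J)
    (h' : ∀ u v, projCyl F G Cl Cg t u v ⊆ I → projCyl F G Cl Cg t (U' ++ u) (V' ++ v) ⊆ J)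
    (m n : ℕ) : ∃ m' n', |F.wslope U| ^ dl * |G.wslope V| ^ dg * projMass F G Cl Cg dl dg t m n I +
      |F.wslope U'| ^ dl * |G.wslope V'| ^ dg * projMass F G Cl Cg dl dg t m n I ≤
      projMass F G Cl Cg dl dg t m' n' J := by
  classical
  have hp := F.rate_rpow_nonneg dl
  have hq := G.rate_rpow_nonneg dg
  have hite : ∀ P : Prop, (0 : ℝ) ≤ if P then 1 else 0 := fun P => by split_ifs <;> norm_num
  let n' := max V.length V'.length + n
  let f : List (Fin A) → ℝ := fun u => wordSum (fun j => G.rate j ^ dg) n' fun v =>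
    if projCyl F G Cl Cg t u v ⊆ J then 1 else 0
  have hf0 : ∀ u, 0 ≤ f u := fun u => wordSum_nonneg hq fun _ => hite _
  have hfm : ∀ u i, f u ≤ f (u ++ [i]) := by
    refine fun u i => wordSum_mono hq fun v => ?_
    by_cases hJ : projCyl F G Cl Cg t u v ⊆ J
    · rw [if_pos hJ, if_pos]
      rw [projCyl_append_left hCl] at hJ
      exact (Set.subset_iUnion _ i).trans hJ
    · rw [if_neg hJ]; exact hite _
  have key : ∀ (W : List (Fin A)) (Z : List (Fin B)), Z.length ≤ max V.length V'.length →
      (∀ u v, projCyl F G Cl Cg t u v ⊆ I → projCyl F G Cl Cg t (W ++ u) (Z ++ v) ⊆ J) →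
      |F.wslope W| ^ dl * |G.wslope Z| ^ dg * projMass F G Cl Cg dl dg t m n I ≤
      (W.map fun i => F.rate i ^ dl).prod *
        wordSum (fun i => F.rate i ^ dl) m fun u => f (W ++ u) := by
    intro W Z hZ hWZ
    rw [F.prod_rate_rpow, mul_assoc]
    refine mul_le_mul_of_nonneg_left ?_ (Real.rpow_nonneg (abs_nonneg _) _)
    have e := wordSum_affine hdl m (fun u => wordSum (fun j => G.rate j ^ dg) n fun v =>
      if projCyl F G Cl Cg t u v ⊆ I then (1 : ℝ) else 0) 0 (|G.wslope Z| ^ dg)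
    rw [zero_add] at e
    rw [projMass, ← e]
    refine wordSum_mono hp fun u => ?_
    rw [zero_add, ← G.prod_rate_rpow]
    refine le_trans (mul_le_mul_of_nonneg_left (wordSum_mono hq fun v => ?_)
      (by rw [G.prod_rate_rpow]; exact Real.rpow_nonneg (abs_nonneg _) _))
      ((le_wordSum_append hq Z n (f := fun v =>
        if projCyl F G Cl Cg t (W ++ u) v ⊆ J then (1 : ℝ) else 0) fun _ => hite _).trans
      (monotone_wordSum hq hdg (f := fun v =>
        if projCyl F G Cl Cg t (W ++ u) v ⊆ J then (1 : ℝ) else 0) (fun v j => ?_)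
        (show Z.length + n ≤ n' by omega)))
    · by_cases hI : projCyl F G Cl Cg t u v ⊆ I
      · rw [if_pos hI, if_pos (hWZ u v hI)]
      · rw [if_neg hI]; exact hite _
    · by_cases hJ : projCyl F G Cl Cg t (W ++ u) v ⊆ J
      · rw [if_pos hJ, if_pos]
        rw [projCyl_append_right hCg] at hJ
        exact (Set.subset_iUnion _ j).trans hJ
      · rw [if_neg hJ]; exact hite _
  obtain ⟨M, hM⟩ := hU.add_le_wordSum hp hdl hf0 hfm m
  exact ⟨M, n', (add_le_add (key U V (le_max_left _ _) h) (key U' V' (le_max_right _ _) h')).trans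
    hM⟩

/-- If the slopes of two words almost agree, then appending them acts on projected cylinders
almost as a single affine map. -/
theorem projCyl_append_subset (hCg : G.IsAttractor Cg) {R : ℝ} (hR : ∀ y ∈ Cg, |y| ≤ R)
    {t z h η : ℝ} {U : List (Fin A)} {V : List (Fin B)}
    (hη : |t| * |G.wslope V / F.wslope U - 1| * R ≤ η) {u : List (Fin A)} {v : List (Fin B)}
    (huv : projCyl F G Cl Cg t u v ⊆ Metric.closedBall z h) :
    projCyl F G Cl Cg t (U ++ u) (V ++ v) ⊆
      Metric.closedBall (F.wshift U + t * G.wshift V + F.wslope U * z)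
        (|F.wslope U| * (h + η)) := by
  rintro _ ⟨x, hx, y, hy, rfl⟩
  have h1 := huv ⟨x, hx, y, hy, rfl⟩
  rw [Metric.mem_closedBall, Real.dist_eq] at h1 ⊢
  rw [AffineIFS.wmap_append, AffineIFS.wmap_append]
  set p := F.wmap u x
  have hq := hR _ (hCg.wmap_mem v hy)
  set q := G.wmap v y
  have e : F.wmap U p + t * G.wmap V q - (F.wshift U + t * G.wshift V + F.wslope U * z) =
      F.wslope U * ((p + t * q - z) + t * (G.wslope V / F.wslope U - 1) * q) := by
    have := F.wslope_ne_zero U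
    simp only [AffineIFS.wmap]; field_simp; ring
  rw [e, abs_mul]
  gcongr
  refine (abs_add_le _ _).trans (add_le_add h1 (le_trans ?_ hη))
  rw [abs_mul, abs_mul]
  gcongr

theorem exists_doubling_constant (a b s : ℝ) :
    ∃ θ : ℝ, 0 < θ ∧ θ < 1 ∧
      (1 + 4 * θ) ^ s < 3 / 2 * ((1 - θ) ^ a * ((1 - θ) ^ 2) ^ b) := by
  have hcont : Tendsto (fun θ : ℝ => 3 / 2 * ((1 - θ) ^ a * ((1 - θ) ^ 2) ^ b) - (1 + 4 * θ) ^ s)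
      (𝓝[>] 0) (𝓝 (3 / 2 * ((1 - 0) ^ a * ((1 - 0) ^ 2) ^ b) - (1 + 4 * 0) ^ s)) := by
    refine tendsto_nhdsWithin_of_tendsto_nhds (ContinuousAt.tendsto ?_)
    refine ContinuousAt.sub (continuousAt_const.mul (ContinuousAt.mul ?_ ?_)) ?_
    · exact ContinuousAt.rpow_const (by fun_prop) (Or.inl (by norm_num))
    · exact ContinuousAt.rpow_const (by fun_prop) (Or.inl (by norm_num))
    · exact ContinuousAt.rpow_const (by fun_prop) (Or.inl (by norm_num))
  have h0 := hcont.eventually (lt_mem_nhds (show (0:ℝ) < _ by norm_num))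
  obtain ⟨θ, ⟨h1, h2⟩, h3⟩ := (h0.and (Ioo_mem_nhdsGT (show (0:ℝ) < 1 by norm_num))).exists
    |>.imp fun θ h => (⟨⟨h.1, h.2⟩, trivial⟩ : (_ ∧ _) ∧ True)
  exact ⟨θ, h2.1, h2.2, by linarith⟩

/-- Elementary estimate for a quotient of numbers close to `1`. -/
theorem abs_mul_div_sub_one_le {σ a b ε₀ ε : ℝ} (h₀1 : ε₀ ≤ 1) (hε : 0 < ε)
    (hε₀ : ε ≤ ε₀ / 5) (hσ : |σ - 1| < ε₀) (ha : |a - 1| < ε) (hb : |b - 1| < ε) :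
    |σ * (b / a) - 1| ≤ 2 * ε₀ := by
  have ha' := abs_lt.1 ha
  have hapos : 0 < a := by linarith
  have hb' := abs_lt.1 hb
  have e : σ * (b / a) - 1 = ((σ - 1) * b + (b - 1) - (a - 1)) / a := by field_simp; ring
  rw [e, abs_div, abs_of_pos hapos, div_le_iff₀ hapos]
  have h1 := abs_sub ((σ - 1) * b + (b - 1)) (a - 1)
  have h2 := abs_add_le ((σ - 1) * b) (b - 1)
  rw [abs_mul] at h2
  have hb2 : |b| ≤ 1 + ε := abs_le.2 ⟨by linarith, by linarith⟩
  have h3 : |σ - 1| * |b| ≤ ε₀ * (1 + ε) := mul_le_mul hσ.le hb2 (abs_nonneg _) (by linarith)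
  nlinarith

/-- Close pairs can be extended by common words so that the combined slopes almost agree in both
coordinates. -/
theorem exists_diverge_extension [Nonempty (Fin A)] [Nonempty (Fin B)] {t K : ℝ} (hK : 0 < K)
    (hclose : ∀ ε > 0, ClosePair F G K ε t) (z : ℝ) {η : ℝ} (hη : 0 < η) :
    ∃ U V U' V', Diverge U U' ∧ |F.wslope U' - F.wslope U| ≤ η * |F.wslope U| ∧
      |G.wslope V / F.wslope U - 1| ≤ η ∧ |G.wslope V' / F.wslope U' - 1| ≤ η ∧
      |(F.wshift U' + t * G.wshift V' + F.wslope U' * z) -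
        (F.wshift U + t * G.wshift V + F.wslope U * z)| ≤ η * |F.wslope U| := by
  obtain ⟨ε₀, hε₀, hε₀1, hε₀η⟩ : ∃ ε₀ : ℝ, 0 < ε₀ ∧ ε₀ ≤ 1 ∧ 2 * ε₀ ≤ η :=
    ⟨min 1 (η / 2), by positivity, min_le_left _ _, by linarith [min_le_right 1 (η / 2)]⟩
  choose U V U' V' hdiv hU hV hK1 hK2 hsh using
    fun n : ℕ => hclose (1 / ((n : ℝ) + 1)) (by positivity)
  obtain ⟨w, w', hw⟩ := exists_frequently_suffix F G hK hK1 hK2 hε₀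
  let E : ℝ := 1 + |F.wshift w| + |t| * K * |G.wshift w'| + |F.wslope w| * |z|
  have hE : 0 < E := by positivity
  have hwpos := F.abs_wslope_pos w
  have hev : ∀ᶠ k : ℕ in atTop, 1 / ((k : ℝ) + 1) < min (ε₀ / 5) (η * |F.wslope w| / E) :=
    (tendsto_one_div_add_atTop_nhds_zero_nat (𝕜 := ℝ)).eventually
      (gt_mem_nhds (by positivity))
  obtain ⟨k, hk, hkε⟩ := (hw.and_eventually hev).exists
  have hε : (0 : ℝ) < 1 / ((k : ℝ) + 1) := by positivity
  have hdiv := hdiv k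
  have hU := hU k
  have hV := hV k
  have hK2 := hK2 k
  have hsh := hsh k
  clear hw hev hK1 hclose
  generalize (1 / ((k : ℝ) + 1)) = ε at *
  generalize U k = U at *
  generalize U' k = U' at *
  generalize V k = V at *
  generalize V' k = V' at *
  have hε1 := hkε.trans_le (min_le_left _ _)
  have hε2 := hkε.trans_le (min_le_right _ _)
  rw [lt_div_iff₀ hE] at hε2
  have nU := F.wslope_ne_zero U
  have nU' := F.wslope_ne_zero U'
  have nV := G.wslope_ne_zero V
  have nw := F.wslope_ne_zero w
  have hUp := F.abs_wslope_pos U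
  have hUU : |F.wslope U' - F.wslope U| ≤ ε * |F.wslope U| := by
    have e : F.wslope U' - F.wslope U = (F.wslope U' / F.wslope U - 1) * F.wslope U := by
      field_simp
    rw [e, abs_mul]; gcongr
  have hVV : |G.wslope V' - G.wslope V| ≤ ε * (K * |F.wslope U|) := by
    have e : G.wslope V' - G.wslope V = (G.wslope V' / G.wslope V - 1) * G.wslope V := by
      field_simp
    rw [e, abs_mul]
    rw [abs_div, div_le_iff₀ hUp] at hK2
    gcongr
  have hratio : |G.wslope (V' ++ w') / F.wslope (U' ++ w) - 1| ≤ 2 * ε₀ := by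
    have := abs_mul_div_sub_one_le hε₀1 hε hε1.le hk hU hV
    convert this using 3
    simp only [AffineIFS.wslope_append]
    field_simp
  refine ⟨U ++ w, V ++ w', U' ++ w, V' ++ w', hdiv.append w w, ?_, by linarith, by linarith, ?_⟩
  · have e : F.wslope (U' ++ w) - F.wslope (U ++ w) =
        (F.wslope U' - F.wslope U) * F.wslope w := by
      simp only [AffineIFS.wslope_append]; ring
    have hεη : ε ≤ η := by linarith
    rw [e, AffineIFS.wslope_append, abs_mul, abs_mul, ← mul_assoc]
    gcongr
    exact hUU.trans (by gcongr)
  · have e : (F.wshift (U' ++ w) + t * G.wshift (V' ++ w') + F.wslope (U' ++ w) * z) -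
        (F.wshift (U ++ w) + t * G.wshift (V ++ w') + F.wslope (U ++ w) * z) =
        -((F.wshift U + t * G.wshift V) - (F.wshift U' + t * G.wshift V')) +
        (F.wslope U' - F.wslope U) * F.wshift w + t * ((G.wslope V' - G.wslope V) * G.wshift w') +
        (F.wslope U' - F.wslope U) * F.wslope w * z := by
      simp only [AffineIFS.wshift_append, AffineIFS.wslope_append, AffineIFS.wmap]; ring
    rw [e]
    have h1 : |(F.wslope U' - F.wslope U) * F.wshift w| ≤ ε * |F.wslope U| * |F.wshift w| := by
      rw [abs_mul]; gcongr
    have h2 : |t * ((G.wslope V' - G.wslope V) * G.wshift w')| ≤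
        |t| * (ε * (K * |F.wslope U|) * |G.wshift w'|) := by
      rw [abs_mul, abs_mul]; gcongr
    have h3 : |(F.wslope U' - F.wslope U) * F.wslope w * z| ≤
        ε * |F.wslope U| * |F.wslope w| * |z| := by
      rw [abs_mul, abs_mul]; gcongr
    have h4 : ε * E * |F.wslope U| ≤ η * |F.wslope w| * |F.wslope U| := by gcongr
    have h5 : η * |F.wslope (U ++ w)| = η * |F.wslope w| * |F.wslope U| := by
      rw [AffineIFS.wslope_append, abs_mul]; ring
    rw [h5]
    refine le_trans ?_ h4
    refine (abs_add_le _ _).trans ?_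
    refine (add_le_add_left (abs_add_le _ _) _).trans ?_
    refine (add_le_add_left (add_le_add_left (abs_add_le _ _) _) _).trans ?_
    rw [abs_neg]
    simp only [E]
    linarith

/-- Lower bound for the weight of a cylinder whose slopes almost agree. -/
theorem weight_lower_bound {dl dg θ α X Y : ℝ} (hl : 0 ≤ dl) (hg : 0 ≤ dg) (hθ : θ < 1)
    (hα : 0 < |α|) (hX : (1 - θ) * |α| ≤ |X|) (hY : |Y / X - 1| ≤ θ) :
    (1 - θ) ^ dl * ((1 - θ) ^ 2) ^ dg * |α| ^ (dl + dg) ≤ |X| ^ dl * |Y| ^ dg := by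
  have h1θ : 0 < 1 - θ := by linarith
  have hX0 : 0 < |X| := lt_of_lt_of_le (by positivity) hX
  have hYX : (1 - θ) * |X| ≤ |Y| := by
    have h1 : 1 - θ ≤ |Y / X| := by
      have := (abs_le.1 hY).1
      exact le_trans (by linarith) (le_abs_self _)
    rwa [abs_div, le_div_iff₀ hX0] at h1
  have hY2 : (1 - θ) ^ 2 * |α| ≤ |Y| := by nlinarith
  calc _ = ((1 - θ) * |α|) ^ dl * ((1 - θ) ^ 2 * |α|) ^ dg := by
        rw [Real.mul_rpow h1θ.le hα.le, Real.mul_rpow (by positivity) hα.le,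
          Real.rpow_add hα]; ring
    _ ≤ _ := by gcongr

/-- If there are close pairs of every quality, then the projected mass has unbounded density. -/
theorem exists_projMass_ge (hCl : F.IsAttractor Cl) (hCg : G.IsAttractor Cg)
    {dl dg : ℝ} (hdl : F.IsSimilarityDim dl) (hdg : G.IsSimilarityDim dg) {t K : ℝ} (hK : 0 < K)
    (hclose : ∀ ε > 0, ClosePair F G K ε t) (N : ℝ) :
    ∃ m n z h, 0 < h ∧
      N * h ^ (dl + dg) ≤ projMass F G Cl Cg dl dg t m n (Metric.closedBall z h) := by
  have := hCl.nonempty_index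
  have := hCg.nonempty_index
  have hl0 := hdl.nonneg
  have hg0 := hdg.nonneg
  by_contra! hN
  obtain ⟨R, hR⟩ : ∃ R, ∀ x ∈ Cl ∪ Cg, |x| ≤ R :=
    (hCl.2.1.union hCg.2.1).isBounded.exists_norm_le
  have hRl : ∀ x ∈ Cl, |x| ≤ R := fun x hx => hR x (Or.inl hx)
  have hRg : ∀ x ∈ Cg, |x| ≤ R := fun x hx => hR x (Or.inr hx)
  have hR0 : 0 ≤ R := (abs_nonneg _).trans (hRl _ hCl.1.some_mem)
  let S : Set ℝ := {q | ∃ m n z h, 0 < h ∧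
    q = projMass F G Cl Cg dl dg t m n (Metric.closedBall z h) / h ^ (dl + dg)}
  have hSb : BddAbove S := by
    refine ⟨N, ?_⟩
    rintro _ ⟨m, n, z, h, hh, rfl⟩
    rw [div_le_iff₀ (Real.rpow_pos_of_pos hh _)]
    exact (hN m n z h hh).le
  have hle : ∀ m n z h, 0 < h → projMass F G Cl Cg dl dg t m n (Metric.closedBall z h) ≤
      sSup S * h ^ (dl + dg) := fun m n z h hh => by
    rw [← div_le_iff₀ (Real.rpow_pos_of_pos hh _)]
    exact le_csSup hSb ⟨m, n, z, h, hh, rfl⟩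
  set D := sSup S
  have hD : 0 < D := by
    have hh : 0 < R + |t| * R + 1 := by positivity
    have h1 := hle 0 0 0 _ hh
    have h2 : projMass F G Cl Cg dl dg t 0 0 (Metric.closedBall 0 (R + |t| * R + 1)) = 1 := by
      simp only [projMass, wordSum]
      rw [if_pos]
      rintro _ ⟨x, hx, y, hy, rfl⟩
      rw [AffineIFS.wmap_nil, AffineIFS.wmap_nil, mem_closedBall_zero_iff, Real.norm_eq_abs]
      refine (abs_add_le _ _).trans ?_
      rw [abs_mul]
      have := hRl x hx
      have : |t| * |y| ≤ |t| * R := by gcongr; exact hRg y hy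
      linarith
    rw [h2] at h1
    have := Real.rpow_pos_of_pos hh (dl + dg)
    by_contra! hD
    nlinarith
  have hSne : S.Nonempty := ⟨_, 0, 0, 0, 1, one_pos, rfl⟩
  obtain ⟨_, ⟨m, n, z, h, hh, rfl⟩, hq⟩ := exists_lt_of_lt_csSup hSne
    (show 3 / 4 * D < sSup S by change _ < D; linarith)
  rw [lt_div_iff₀ (Real.rpow_pos_of_pos hh _)] at hq
  obtain ⟨θ, hθ0, hθ1, hθ⟩ := exists_doubling_constant dl dg (dl + dg)
  obtain ⟨η, hη, hηθ, hηh, hηR⟩ : ∃ η : ℝ, 0 < η ∧ η ≤ θ ∧ η ≤ θ * h ∧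
      |t| * η * R ≤ θ * h := by
    refine ⟨min θ (θ * h / (|t| * R + 1)), by positivity, min_le_left _ _, ?_, ?_⟩
    · refine (min_le_right _ _).trans (div_le_self (by positivity) ?_)
      have : 0 ≤ |t| * R := by positivity
      linarith
    · have := min_le_right θ (θ * h / (|t| * R + 1))
      rw [le_div_iff₀ (by positivity)] at this
      have h0 : 0 < min θ (θ * h / (|t| * R + 1)) := by positivity
      linarith
  obtain ⟨U, V, U', V', hdiv, hαα, hratio1, hratio, hcc⟩ := exists_diverge_extension hK hclose z hη
  have hαp := F.abs_wslope_pos U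
  set α := F.wslope U
  set α' := F.wslope U'
  set c := F.wshift U + t * G.wshift V + α * z
  set c' := F.wshift U' + t * G.wshift V' + α' * z
  have hcc : |c' - c| ≤ θ * h * |α| := hcc.trans (by gcongr)
  have hαα : |α' - α| ≤ θ * |α| := hαα.trans (by gcongr)
  have hα'l : (1 - θ) * |α| ≤ |α'| := by
    have := abs_sub_abs_le_abs_sub α α'
    rw [abs_sub_comm] at this
    linarith
  have hα'u : |α'| ≤ (1 + θ) * |α| := by
    have := abs_sub_abs_le_abs_sub α' α
    linarith
  obtain ⟨m', n', hmn⟩ := hdiv.add_le_projMass hCl hCg hdl hdg (t := t)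
    (V := V) (V' := V') (I := Metric.closedBall z h)
    (J := Metric.closedBall c (|α| * h * (1 + 4 * θ)))
    (fun u v huv => (projCyl_append_subset hCg hRg (η := θ * h)
        (le_trans (by gcongr) hηR) huv).trans (Metric.closedBall_subset_closedBall (by
          have : 0 < |α| * h * θ := by positivity
          change |α| * _ ≤ _; nlinarith)))
    (fun u v huv => (projCyl_append_subset hCg hRg (η := θ * h)
        (le_trans (by gcongr) hηR) huv).trans (Metric.closedBall_subset_closedBall' (by
          change |α'| * _ + dist c' c ≤ _
          rw [Real.dist_eq]
          have h1 : |α'| * (h + θ * h) ≤ (1 + θ) * |α| * (h + θ * h) := by gcongr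
          have h2 : 0 < |α| * h * θ * (1 - θ) := by
            have : 0 < 1 - θ := by linarith
            positivity
          nlinarith))) m n
  have hfin := hmn.trans (hle m' n' _ _ (by positivity))
  have h1θ : 0 < 1 - θ := by linarith
  have w1 := weight_lower_bound hl0 hg0 hθ1 hαp (show (1 - θ) * |α| ≤ |α| by nlinarith)
    (hratio1.trans hηθ)
  have w2 := weight_lower_bound hl0 hg0 hθ1 hαp hα'l (hratio.trans hηθ)
  set μ := projMass F G Cl Cg dl dg t m n (Metric.closedBall z h)
  have hμ0 : 0 ≤ μ := projMass_nonneg _ _ _ _ _ _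
  have a1 := mul_le_mul_of_nonneg_right w1 hμ0
  have a2 := mul_le_mul_of_nonneg_right w2 hμ0
  rw [Real.mul_rpow (by positivity) (by positivity), Real.mul_rpow hαp.le hh.le] at hfin
  have hb := Real.rpow_pos_of_pos hαp (dl + dg)
  have hhp := Real.rpow_pos_of_pos hh (dl + dg)
  set κ := (1 - θ) ^ dl * ((1 - θ) ^ 2) ^ dg
  have hκ : 0 < κ := by positivity
  have a3 : 2 * (κ * |α| ^ (dl + dg)) * (3 / 4 * D * h ^ (dl + dg)) ≤
      2 * (κ * |α| ^ (dl + dg)) * μ := by gcongr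
  have a4 : D * (|α| ^ (dl + dg) * h ^ (dl + dg) * (1 + 4 * θ) ^ (dl + dg)) <
      D * (|α| ^ (dl + dg) * h ^ (dl + dg) * (3 / 2 * κ)) := by gcongr
  linarith

end Mass

section Content

open Filter Topology

/-- The Hausdorff content of dimension `s` on the line. -/
noncomputable def hausdorffContent (s : ℝ) : OuterMeasure ℝ :=
  OuterMeasure.boundedBy fun A => Metric.ediam A ^ s

theorem hausdorffContent_le {s : ℝ} (hs : 0 ≤ s) {A : Set ℝ} {z h : ℝ} (hh : 0 ≤ h)
    (hA : A ⊆ Metric.closedBall z h) : hausdorffContent s A ≤ ENNReal.ofReal ((2 * h) ^ s) := by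
  refine (measure_mono hA).trans ((OuterMeasure.boundedBy_le _).trans ?_)
  rw [← ENNReal.ofReal_rpow_of_nonneg (by positivity) hs]
  refine ENNReal.rpow_le_rpow ?_ hs
  rw [Real.closedBall_eq_Icc, Real.ediam_Icc]
  exact ENNReal.ofReal_le_ofReal (by linarith)

theorem toReal_hausdorffContent_le {s : ℝ} (hs : 0 ≤ s) {A : Set ℝ} {z h : ℝ} (hh : 0 ≤ h)
    (hA : A ⊆ Metric.closedBall z h) : (hausdorffContent s A).toReal ≤ (2 * h) ^ s :=
  ENNReal.toReal_le_of_le_ofReal (by positivity) (hausdorffContent_le hs hh hA)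

/-- Sets of zero Hausdorff content have zero Hausdorff measure. -/
theorem hausdorffMeasure_eq_zero_of_hausdorffContent {s : ℝ} (hs : 0 < s) {A : Set ℝ}
    (hA : hausdorffContent s A = 0) : μH[s] A = 0 := by
  rw [Measure.hausdorffMeasure_apply]
  simp only [ENNReal.iSup_eq_zero]
  intro r hr
  refine le_antisymm (ENNReal.le_of_forall_pos_le_add fun ε hε _ => ?_) (by simp)
  have hpos : 0 < min (ε : ENNReal) (r ^ s) :=
    lt_min (by exact_mod_cast hε) (ENNReal.rpow_pos_of_nonneg hr hs.le)
  rw [hausdorffContent, OuterMeasure.boundedBy_apply] at hA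
  rw [← hA] at hpos
  simp only [iInf_lt_iff] at hpos
  obtain ⟨T, hT, hlt⟩ := hpos
  refine iInf_le_of_le T (iInf_le_of_le hT (iInf_le_of_le (fun n => ?_) ?_))
  · rcases (T n).eq_empty_or_nonempty with h | h
    · simp [h]
    · have h1 : Metric.ediam (T n) ^ s ≤ r ^ s := by
        refine le_trans ?_ (hlt.le.trans (min_le_right _ _))
        refine le_trans ?_ (ENNReal.le_tsum n)
        exact le_iSup (fun _ : (T n).Nonempty => Metric.ediam (T n) ^ s) h
      exact (ENNReal.rpow_le_rpow_iff hs).1 h1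
  · rw [zero_add]; exact hlt.le.trans (min_le_left _ _)

theorem le_wordSum_wordSum_append {α β : Type*} [Fintype α] [Fintype β] {p : α → ℝ} {q : β → ℝ}
    (hp : ∀ i, 0 ≤ p i) (hq : ∀ i, 0 ≤ q i) (hp1 : ∑ i, p i = 1) (w : List α) (z : List β) (m n : ℕ)
    {f : List α → List β → ℝ} (hf : ∀ u v, 0 ≤ f u v) :
    (w.map p).prod * (z.map q).prod *
        wordSum p m (fun u => wordSum q n fun v => f (w ++ u) (z ++ v)) ≤
      wordSum p (w.length + m) fun u => wordSum q (z.length + n) fun v => f u v := by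
  have hw : 0 ≤ (w.map p).prod := List.prod_nonneg (by simpa using fun i _ => hp i)
  have e := wordSum_affine hp1 m (fun u => wordSum q n fun v => f (w ++ u) (z ++ v)) 0
    (z.map q).prod
  rw [zero_add] at e
  rw [mul_assoc, ← e]
  refine le_trans (mul_le_mul_of_nonneg_left (wordSum_mono hp fun u => ?_) hw)
    (le_wordSum_append hp w m
      (f := fun u => wordSum q (z.length + n) fun v => f u v) fun u => wordSum_nonneg hq (hf u))
  rw [zero_add]
  exact le_wordSum_append hq z n (hf _)

variable {A B : ℕ} {F : AffineIFS A} {G : AffineIFS B} {Cl Cg : Set ℝ}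

theorem le_of_comparable_aux {dl : ℝ} (hdl : F.IsSimilarityDim dl) {c ρ : ℝ}
    (hc : 0 < c) (hρ : ρ < 1) (hF : ∀ i, c ≤ F.rate i ∧ F.rate i ≤ ρ) [Nonempty (Fin A)]
    {q : List (Fin A) → List (Fin B) → ℝ}
    (hq : ∀ u v, q u v ≤ ∑ i, F.rate i ^ dl * q (u ++ [i]) v) {Θ : ℝ}
    (hΘ : ∀ u v, c * |F.wslope u| ≤ |G.wslope v| → c * |G.wslope v| ≤ |F.wslope u| → q u v ≤ Θ)
    (u : List (Fin A)) (v : List (Fin B)) (huv : c * |G.wslope v| ≤ |F.wslope u|) : q u v ≤ Θ := by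
  have i₀ : Fin A := Classical.arbitrary _
  have hρ0 : 0 < ρ := (F.rate_pos i₀).trans_le (hF i₀).2
  have hc1 : c ≤ 1 := (hF i₀).1.trans (F.rate_lt_one i₀).le
  have key : ∀ (k : ℕ) (u : List (Fin A)), c * |G.wslope v| ≤ |F.wslope u| →
      c * ρ ^ k * |F.wslope u| ≤ |G.wslope v| → q u v ≤ Θ := by
    intro k
    induction k with
    | zero => exact fun u h1 h2 => hΘ u v (by simpa using h2) h1
    | succ k ih =>
      intro u h1 h2
      by_cases h3 : c * |F.wslope u| ≤ |G.wslope v|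
      · exact hΘ u v h3 h1
      · push Not at h3
        have hu := F.abs_wslope_pos u
        have hv := G.abs_wslope_pos v
        calc q u v ≤ ∑ i, F.rate i ^ dl * q (u ++ [i]) v := hq u v
          _ ≤ ∑ i, F.rate i ^ dl * Θ := by
            refine Finset.sum_le_sum fun i _ =>
              mul_le_mul_of_nonneg_left (ih _ ?_ ?_) (F.rate_rpow_nonneg dl i)
            · have e : |F.wslope (u ++ [i])| = |F.wslope u| * F.rate i := by
                simp [AffineIFS.wslope_append, abs_mul, AffineIFS.rate]
              rw [e]
              nlinarith [(hF i).1]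
            · have e : |F.wslope (u ++ [i])| = |F.wslope u| * F.rate i := by
                simp [AffineIFS.wslope_append, abs_mul, AffineIFS.rate]
              rw [e]
              calc c * ρ ^ k * (|F.wslope u| * F.rate i) ≤ c * ρ ^ k * (|F.wslope u| * ρ) := by
                    gcongr; exact (hF i).2
                _ = c * ρ ^ (k + 1) * |F.wslope u| := by ring
                _ ≤ _ := h2
          _ = Θ := by rw [← Finset.sum_mul, hdl, one_mul]
  have hu := F.abs_wslope_pos u
  obtain ⟨k, hk⟩ := exists_pow_lt_of_lt_one
    (show 0 < |G.wslope v| / (c * |F.wslope u|) from div_pos (G.abs_wslope_pos v) (by positivity)) hρ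
  refine key k u huv ?_
  rw [lt_div_iff₀ (by positivity)] at hk
  linarith

/-- A bound for a function that is subharmonic in both words follows from the bound for pairs of
words of comparable sizes. -/
theorem le_of_comparable {dl dg : ℝ} (hdl : F.IsSimilarityDim dl) (hdg : G.IsSimilarityDim dg)
    {c ρ : ℝ} (hc : 0 < c) (hρ : ρ < 1) (hF : ∀ i, c ≤ F.rate i ∧ F.rate i ≤ ρ)
    (hG : ∀ i, c ≤ G.rate i ∧ G.rate i ≤ ρ) [Nonempty (Fin A)] [Nonempty (Fin B)]
    {q : List (Fin A) → List (Fin B) → ℝ}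
    (hq : ∀ u v, q u v ≤ ∑ i, F.rate i ^ dl * q (u ++ [i]) v)
    (hq' : ∀ u v, q u v ≤ ∑ j, G.rate j ^ dg * q u (v ++ [j])) {Θ : ℝ}
    (hΘ : ∀ u v, c * |F.wslope u| ≤ |G.wslope v| → c * |G.wslope v| ≤ |F.wslope u| → q u v ≤ Θ)
    (u : List (Fin A)) (v : List (Fin B)) : q u v ≤ Θ := by
  have i₀ : Fin A := Classical.arbitrary _
  have hc1 : c ≤ 1 := (hF i₀).1.trans (F.rate_lt_one i₀).le
  have hu := F.abs_wslope_pos u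
  have hv := G.abs_wslope_pos v
  rcases le_total |F.wslope u| |G.wslope v| with h | h
  · exact le_of_comparable_aux (F := G) (G := F) (q := fun v u => q u v) hdg hc hρ hG
      (fun v u => hq' u v) (fun v u h1 h2 => hΘ u v h2 h1) v u (by nlinarith)
  · exact le_of_comparable_aux hdl hc hρ hF hq hΘ u v (by nlinarith)

/-- The content of a projected cylinder outside of `J`, relative to the weight of the cylinder. -/
noncomputable def relContent (F : AffineIFS A) (G : AffineIFS B) (Cl Cg : Set ℝ) (dl dg t : ℝ)
    (J : Set ℝ) (u : List (Fin A)) (v : List (Fin B)) : ℝ :=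
  (hausdorffContent (dl + dg) (projCyl F G Cl Cg t u v \ J)).toReal /
    (|F.wslope u| ^ dl * |G.wslope v| ^ dg)

theorem weight_pos (dl dg : ℝ) (u : List (Fin A)) (v : List (Fin B)) :
    0 < |F.wslope u| ^ dl * |G.wslope v| ^ dg :=
  mul_pos (Real.rpow_pos_of_pos (F.abs_wslope_pos u) _)
    (Real.rpow_pos_of_pos (G.abs_wslope_pos v) _)

theorem projCyl_subset_closedBall {R : ℝ} (hRl : ∀ x ∈ Cl, |x| ≤ R) (hRg : ∀ y ∈ Cg, |y| ≤ R)
    (t : ℝ) (u : List (Fin A)) (v : List (Fin B)) :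
    projCyl F G Cl Cg t u v ⊆ Metric.closedBall (F.wshift u + t * G.wshift v)
      (|F.wslope u| * R + |t| * |G.wslope v| * R) := by
  rintro _ ⟨x, hx, y, hy, rfl⟩
  rw [Metric.mem_closedBall, Real.dist_eq]
  have e : F.wmap u x + t * G.wmap v y - (F.wshift u + t * G.wshift v) =
      F.wslope u * x + t * G.wslope v * y := by simp only [AffineIFS.wmap]; ring
  rw [e]
  refine (abs_add_le _ _).trans ?_
  rw [abs_mul, abs_mul, abs_mul]
  gcongr
  · exact hRl x hx
  · exact hRg y hy

theorem exists_abs_le (hCl : F.IsAttractor Cl) (hCg : G.IsAttractor Cg) :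
    ∃ R, 0 ≤ R ∧ (∀ x ∈ Cl, |x| ≤ R) ∧ ∀ y ∈ Cg, |y| ≤ R := by
  obtain ⟨R, hR⟩ : ∃ R, ∀ x ∈ Cl ∪ Cg, |x| ≤ R :=
    (hCl.2.1.union hCg.2.1).isBounded.exists_norm_le
  exact ⟨R, (abs_nonneg _).trans (hR _ (Or.inl hCl.1.some_mem)), fun x hx => hR x (Or.inl hx),
    fun x hx => hR x (Or.inr hx)⟩

theorem hausdorffContent_projCyl_ne_top (hCl : F.IsAttractor Cl) (hCg : G.IsAttractor Cg) {s : ℝ}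
    (hs : 0 ≤ s) (t : ℝ) (J : Set ℝ) (u : List (Fin A)) (v : List (Fin B)) :
    hausdorffContent s (projCyl F G Cl Cg t u v \ J) ≠ ⊤ := by
  obtain ⟨R, hR0, hRl, hRg⟩ := exists_abs_le hCl hCg
  exact ne_top_of_le_ne_top ENNReal.ofReal_ne_top (hausdorffContent_le hs (by positivity)
    (Set.sdiff_subset.trans (projCyl_subset_closedBall hRl hRg t u v)))

theorem toReal_content_iUnion_le {ι : Type*} [Fintype ι] {s : ℝ} {X : ι → Set ℝ}
    (h : ∀ i, hausdorffContent s (X i) ≠ ⊤) :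
    (hausdorffContent s (⋃ i, X i)).toReal ≤ ∑ i, (hausdorffContent s (X i)).toReal := by
  rw [← ENNReal.toReal_sum fun i _ => h i]
  exact ENNReal.toReal_mono (ENNReal.sum_ne_top.2 fun i _ => h i)
    ((measure_iUnion_le X).trans_eq (tsum_fintype _))

theorem relContent_le_left (hCl : F.IsAttractor Cl) (hCg : G.IsAttractor Cg) {dl dg : ℝ}
    (hs : 0 ≤ dl + dg) (t : ℝ) (J : Set ℝ) (u : List (Fin A)) (v : List (Fin B)) :
    relContent F G Cl Cg dl dg t J u v ≤
      ∑ i, F.rate i ^ dl * relContent F G Cl Cg dl dg t J (u ++ [i]) v := by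
  rw [relContent, projCyl_append_left hCl, Set.iUnion_sdiff]
  refine (div_le_div_of_nonneg_right (toReal_content_iUnion_le fun i =>
    hausdorffContent_projCyl_ne_top hCl hCg hs t J _ _) (weight_pos dl dg u v).le).trans_eq ?_
  rw [Finset.sum_div]
  refine Finset.sum_congr rfl fun i _ => ?_
  have e : |F.wslope (u ++ [i])| ^ dl = |F.wslope u| ^ dl * F.rate i ^ dl := by
    rw [AffineIFS.wslope_append, abs_mul, Real.mul_rpow (abs_nonneg _) (abs_nonneg _)]
    simp [AffineIFS.rate]
  have h1 := Real.rpow_pos_of_pos (F.rate_pos i) dl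
  have h2 := Real.rpow_pos_of_pos (F.abs_wslope_pos u) dl
  have h3 := Real.rpow_pos_of_pos (G.abs_wslope_pos v) dg
  rw [relContent, e]
  field_simp

theorem relContent_le_right (hCl : F.IsAttractor Cl) (hCg : G.IsAttractor Cg) {dl dg : ℝ}
    (hs : 0 ≤ dl + dg) (t : ℝ) (J : Set ℝ) (u : List (Fin A)) (v : List (Fin B)) :
    relContent F G Cl Cg dl dg t J u v ≤
      ∑ j, G.rate j ^ dg * relContent F G Cl Cg dl dg t J u (v ++ [j]) := by
  rw [relContent, projCyl_append_right hCg, Set.iUnion_sdiff]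
  refine (div_le_div_of_nonneg_right (toReal_content_iUnion_le fun i =>
    hausdorffContent_projCyl_ne_top hCl hCg hs t J _ _) (weight_pos dl dg u v).le).trans_eq ?_
  rw [Finset.sum_div]
  refine Finset.sum_congr rfl fun i _ => ?_
  have e : |G.wslope (v ++ [i])| ^ dg = |G.wslope v| ^ dg * G.rate i ^ dg := by
    rw [AffineIFS.wslope_append, abs_mul, Real.mul_rpow (abs_nonneg _) (abs_nonneg _)]
    simp [AffineIFS.rate]
  have h1 := Real.rpow_pos_of_pos (G.rate_pos i) dg
  have h2 := Real.rpow_pos_of_pos (F.abs_wslope_pos u) dl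
  have h3 := Real.rpow_pos_of_pos (G.abs_wslope_pos v) dg
  rw [relContent, e]
  field_simp

/-- Relative contents are uniformly bounded. -/
theorem exists_relContent_le (hCl : F.IsAttractor Cl) (hCg : G.IsAttractor Cg) {dl dg : ℝ}
    (hdl : F.IsSimilarityDim dl) (hdg : G.IsSimilarityDim dg) {c ρ : ℝ} (hc : 0 < c) (hρ : ρ < 1)
    (hF : ∀ i, c ≤ F.rate i ∧ F.rate i ≤ ρ) (hG : ∀ i, c ≤ G.rate i ∧ G.rate i ≤ ρ) (t : ℝ) :
    ∃ M, ∀ u v, relContent F G Cl Cg dl dg t ∅ u v ≤ M := by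
  have := hCl.nonempty_index
  have := hCg.nonempty_index
  have hl0 := hdl.nonneg
  have hg0 := hdg.nonneg
  have hs : 0 ≤ dl + dg := add_nonneg hl0 hg0
  obtain ⟨R, hR0, hRl, hRg⟩ := exists_abs_le hCl hCg
  let L := R + |t| * c⁻¹ * R
  have hL : 0 ≤ L := by positivity
  refine ⟨(2 * L) ^ (dl + dg) / c ^ dg, le_of_comparable hdl hdg hc hρ hF hG
    (relContent_le_left hCl hCg hs t ∅) (relContent_le_right hCl hCg hs t ∅)
    fun u v h1 h2 => ?_⟩
  have hu := F.abs_wslope_pos u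
  rw [relContent, div_le_div_iff₀ (weight_pos dl dg u v) (Real.rpow_pos_of_pos hc _),
    Set.sdiff_empty]
  have h3 : projCyl F G Cl Cg t u v ⊆ Metric.closedBall (F.wshift u + t * G.wshift v)
      (|F.wslope u| * L) := by
    refine (projCyl_subset_closedBall hRl hRg t u v).trans
      (Metric.closedBall_subset_closedBall ?_)
    have : |G.wslope v| ≤ c⁻¹ * |F.wslope u| := by
      rwa [inv_mul_eq_div, le_div_iff₀ hc, mul_comm]
    calc _ ≤ |F.wslope u| * R + |t| * (c⁻¹ * |F.wslope u|) * R := by gcongr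
      _ = _ := by simp only [L]; ring
  have h4 := toReal_hausdorffContent_le hs (by positivity) h3
  calc _ ≤ (2 * (|F.wslope u| * L)) ^ (dl + dg) * c ^ dg := by gcongr
    _ = (2 * L) ^ (dl + dg) * (|F.wslope u| ^ dl * (c * |F.wslope u|) ^ dg) := by
      rw [show 2 * (|F.wslope u| * L) = 2 * L * |F.wslope u| by ring,
        Real.mul_rpow (by positivity) hu.le, Real.mul_rpow hc.le hu.le, Real.rpow_add hu]
      ring
    _ ≤ _ := by gcongr

/-- Removing a set which receives mass from the descendants of a cylinder lowers the bound for
its relative content. -/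
theorem relContent_le_one_sub (hCl : F.IsAttractor Cl) (hCg : G.IsAttractor Cg) {dl dg : ℝ}
    (hdl : F.IsSimilarityDim dl) (hdg : G.IsSimilarityDim dg) {t Θ : ℝ} (hΘ0 : 0 ≤ Θ)
    (hΘ : ∀ u v, relContent F G Cl Cg dl dg t ∅ u v ≤ Θ) {u w : List (Fin A)}
    {v w' : List (Fin B)} {I J : Set ℝ} (m n : ℕ)
    (hIJ : ∀ u' v', projCyl F G Cl Cg t u' v' ⊆ I →
      projCyl F G Cl Cg t (u ++ w ++ u') (v ++ w' ++ v') ⊆ J) :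
    relContent F G Cl Cg dl dg t J u v ≤
      Θ * (1 - |F.wslope w| ^ dl * |G.wslope w'| ^ dg * projMass F G Cl Cg dl dg t m n I) := by
  classical
  have := hCl.nonempty_index
  have := hCg.nonempty_index
  have hs : 0 ≤ dl + dg := add_nonneg hdl.nonneg hdg.nonneg
  have hp := F.rate_rpow_nonneg dl
  have hq := G.rate_rpow_nonneg dg
  let f : List (Fin A) → List (Fin B) → ℝ := fun u' v' =>
    if projCyl F G Cl Cg t (u ++ u') (v ++ v') ⊆ J then 1 else 0
  have hf0 : ∀ u' v', 0 ≤ f u' v' := fun u' v' => by simp only [f]; split_ifs <;> norm_num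
  have hrel : ∀ u' v', relContent F G Cl Cg dl dg t J (u ++ u') (v ++ v') ≤
      Θ + -Θ * f u' v' := by
    intro u' v'
    simp only [f]
    split_ifs with h
    · rw [relContent, Set.sdiff_eq_empty.2 h]; simp
    · rw [mul_zero, add_zero]
      refine le_trans ?_ (hΘ (u ++ u') (v ++ v'))
      refine div_le_div_of_nonneg_right ?_ (weight_pos dl dg _ _).le
      exact ENNReal.toReal_mono (hausdorffContent_projCyl_ne_top hCl hCg hs t _ _ _)
        (measure_mono (Set.sdiff_subset_sdiff_right (Set.empty_subset _)))
  have h1 : relContent F G Cl Cg dl dg t J u v ≤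
      wordSum (fun i => F.rate i ^ dl) (w.length + m) fun u' =>
        wordSum (fun j => G.rate j ^ dg) (w'.length + n) fun v' => Θ + -Θ * f u' v' := by
    refine (le_wordSum_of_subharmonic hp
      (g := fun u' => relContent F G Cl Cg dl dg t J u' v)
      (fun u' => relContent_le_left hCl hCg hs t J u' v) (w.length + m) u).trans ?_
    refine wordSum_mono hp fun u' => ?_
    refine (le_wordSum_of_subharmonic hq
      (relContent_le_right hCl hCg hs t J (u ++ u')) (w'.length + n) v).trans ?_
    exact wordSum_mono hq fun v' => hrel u' v'
  simp_rw [wordSum_affine hdg, wordSum_affine hdl] at h1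
  have h2 := le_wordSum_wordSum_append hp hq hdl w w' m n hf0
  rw [F.prod_rate_rpow, G.prod_rate_rpow] at h2
  have h3 : projMass F G Cl Cg dl dg t m n I ≤
      wordSum (fun i => F.rate i ^ dl) m fun u' =>
        wordSum (fun j => G.rate j ^ dg) n fun v' => f (w ++ u') (w' ++ v') := by
    refine wordSum_mono hp fun u' => wordSum_mono hq fun v' => ?_
    split_ifs with h
    · simp only [f]
      rw [if_pos]
      rw [← List.append_assoc, ← List.append_assoc]
      exact hIJ u' v' h
    · exact hf0 _ _
  have h4 := mul_le_mul_of_nonneg_left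
    ((mul_le_mul_of_nonneg_left h3 (weight_pos dl dg w w').le).trans h2) hΘ0
  linarith

/-- If the projected mass has unbounded density, then the projection has zero content. -/
theorem hausdorffContent_projCyl_eq_zero (hCl : F.IsAttractor Cl) (hCg : G.IsAttractor Cg)
    {dl dg : ℝ} (hdl : F.IsSimilarityDim dl) (hdg : G.IsSimilarityDim dg) {c ρ : ℝ} (hc : 0 < c)
    (hρ : ρ < 1) (hF : ∀ i, c ≤ F.rate i ∧ F.rate i ≤ ρ) (hG : ∀ i, c ≤ G.rate i ∧ G.rate i ≤ ρ)
    {t : ℝ} (hmass : ∀ N : ℝ, ∃ m n z h, 0 < h ∧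
      N * h ^ (dl + dg) ≤ projMass F G Cl Cg dl dg t m n (Metric.closedBall z h)) :
    hausdorffContent (dl + dg) (projCyl F G Cl Cg t [] []) = 0 := by
  have := hCl.nonempty_index
  have := hCg.nonempty_index
  have hl0 := hdl.nonneg
  have hg0 := hdg.nonneg
  have hs : 0 ≤ dl + dg := add_nonneg hl0 hg0
  obtain ⟨R, hR0, hRl, hRg⟩ := exists_abs_le hCl hCg
  obtain ⟨M, hM⟩ := exists_relContent_le hCl hCg hdl hdg hc hρ hF hG t
  let S : Set ℝ := {x | ∃ u v, x = relContent F G Cl Cg dl dg t ∅ u v}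
  have hSb : BddAbove S := ⟨M, by rintro _ ⟨u, v, rfl⟩; exact hM u v⟩
  have hΘ : ∀ u v, relContent F G Cl Cg dl dg t ∅ u v ≤ sSup S := fun u v =>
    le_csSup hSb ⟨u, v, rfl⟩
  have hnn : ∀ u v, 0 ≤ relContent F G Cl Cg dl dg t ∅ u v := fun u v =>
    div_nonneg ENNReal.toReal_nonneg (weight_pos dl dg u v).le
  rcases (hnn [] []).eq_or_lt with h0 | h0
  · have h1 := hausdorffContent_projCyl_ne_top hCl hCg hs t ∅ [] []
    rw [relContent, AffineIFS.wslope_nil, AffineIFS.wslope_nil, Set.sdiff_empty] at h0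
    rw [Set.sdiff_empty] at h1
    simp only [abs_one, Real.one_rpow, mul_one, div_one] at h0
    exact ((ENNReal.toReal_eq_zero_iff _).1 h0.symm).resolve_right h1
  exfalso
  have hΘ0 : 0 < sSup S := h0.trans_le (hΘ _ _)
  have hSlub : ∀ Θ', (∀ u v, relContent F G Cl Cg dl dg t ∅ u v ≤ Θ') → sSup S ≤ Θ' :=
    fun Θ' h => csSup_le ⟨_, [], [], rfl⟩ (by rintro _ ⟨u, v, rfl⟩; exact h u v)
  set Θ := sSup S
  have hseq : ∀ k : ℕ, ∃ u v, c * |F.wslope u| ≤ |G.wslope v| ∧ c * |G.wslope v| ≤ |F.wslope u| ∧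
      Θ - 1 / ((k : ℝ) + 1) < relContent F G Cl Cg dl dg t ∅ u v := by
    intro k
    by_contra! h
    have h1 := hSlub _ (le_of_comparable hdl hdg hc hρ hF hG
      (relContent_le_left hCl hCg hs t ∅) (relContent_le_right hCl hCg hs t ∅) h)
    have : (0 : ℝ) < 1 / ((k : ℝ) + 1) := by positivity
    linarith
  choose u v hK1 hK2 huv using hseq
  obtain ⟨m, n, z, h, hh, hμ⟩ := hmass (2 * (4 ^ (dl + dg) * 2 ^ dg) / Θ)
  set μ := projMass F G Cl Cg dl dg t m n (Metric.closedBall z h)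
  have hhs := Real.rpow_pos_of_pos hh (dl + dg)
  have hμ0 : 0 < μ := lt_of_lt_of_le (by positivity) hμ
  let ε₀ : ℝ := min (1 / 2) (h / (|t| * R + 1))
  have hε₀ : 0 < ε₀ := by positivity
  obtain ⟨w, w', hw⟩ := exists_frequently_suffix F G (u := u) (v := v) (K := c⁻¹) (by positivity)
    (fun k => by
      rw [inv_inv, abs_div, le_div_iff₀ (F.abs_wslope_pos _)]; exact hK1 k)
    (fun k => by
      rw [abs_div, div_le_iff₀ (F.abs_wslope_pos _), inv_mul_eq_div, le_div_iff₀ hc, mul_comm]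
      exact hK2 k) hε₀
  set π := |F.wslope w| ^ dl * |G.wslope w'| ^ dg
  have hπ : 0 < π := weight_pos dl dg w w'
  have hev : ∀ᶠ k : ℕ in atTop, 1 / ((k : ℝ) + 1) < Θ * π * μ / 2 :=
    (tendsto_one_div_add_atTop_nhds_zero_nat (𝕜 := ℝ)).eventually
      (gt_mem_nhds (by positivity))
  obtain ⟨k, hk, hkε⟩ := (hw.and_eventually hev).exists
  have huv := huv k
  generalize u k = u at *
  generalize v k = v at *
  set α := F.wslope (u ++ w) with hα
  have hαp : 0 < |α| := F.abs_wslope_pos _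
  have hε1 : |G.wslope (v ++ w') / α - 1| ≤ 1 / 2 := hk.le.trans (min_le_left _ _)
  have hε2 : |t| * |G.wslope (v ++ w') / α - 1| * R ≤ h := by
    have h1 : |G.wslope (v ++ w') / α - 1| ≤ h / (|t| * R + 1) := hk.le.trans (min_le_right _ _)
    rw [le_div_iff₀ (by positivity)] at h1
    have := abs_nonneg (G.wslope (v ++ w') / α - 1)
    linarith
  set J := Metric.closedBall (F.wshift (u ++ w) + t * G.wshift (v ++ w') + α * z)
    (|α| * (h + h))
  have h1 := relContent_le_one_sub hCl hCg hdl hdg hΘ0.le hΘ (u := u) (w := w) (v := v) (w' := w')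
    (I := Metric.closedBall z h) (J := J) m n
    fun u' v' h' => projCyl_append_subset hCg hRg hε2 h'
  have hW := weight_pos (F := F) (G := G) dl dg u v
  have hJ : (hausdorffContent (dl + dg) J).toReal ≤ (4 * (|α| * h)) ^ (dl + dg) := by
    have := toReal_hausdorffContent_le hs (A := J) (by positivity) le_rfl
    rwa [show 2 * (|α| * (h + h)) = 4 * (|α| * h) by ring] at this
  have hJt : hausdorffContent (dl + dg) J ≠ ⊤ :=
    ne_top_of_le_ne_top ENNReal.ofReal_ne_top (hausdorffContent_le hs (by positivity) le_rfl)
  have hsub : relContent F G Cl Cg dl dg t ∅ u v ≤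
      (4 * (|α| * h)) ^ (dl + dg) / (|F.wslope u| ^ dl * |G.wslope v| ^ dg) +
        relContent F G Cl Cg dl dg t J u v := by
    rw [relContent, relContent, ← add_div]
    refine div_le_div_of_nonneg_right ?_ hW.le
    refine le_trans ?_ (add_le_add_left hJ _)
    have hfin := hausdorffContent_projCyl_ne_top hCl hCg hs t J u v
    rw [← ENNReal.toReal_add hJt hfin, Set.sdiff_empty]
    refine ENNReal.toReal_mono (ENNReal.add_ne_top.2 ⟨hJt, hfin⟩) ?_
    refine (measure_mono (t := J ∪ (projCyl F G Cl Cg t u v \ J)) ?_).trans (measure_union_le _ _)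
    rw [Set.union_sdiff_self]; exact Set.subset_union_right
  have hWπ : |α| ^ (dl + dg) ≤ 2 ^ dg * ((|F.wslope u| ^ dl * |G.wslope v| ^ dg) * π) := by
    have e : (|F.wslope u| ^ dl * |G.wslope v| ^ dg) * π =
        |α| ^ dl * |G.wslope (v ++ w')| ^ dg := by
      rw [hα, AffineIFS.wslope_append, AffineIFS.wslope_append, abs_mul, abs_mul,
        Real.mul_rpow (abs_nonneg _) (abs_nonneg _), Real.mul_rpow (abs_nonneg _) (abs_nonneg _)]
      simp only [π]; ring
    have hγ : |α| ≤ 2 * |G.wslope (v ++ w')| := by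
      have h2 : 1 / 2 ≤ |G.wslope (v ++ w') / α| := by
        have := (abs_le.1 hε1).1
        exact le_trans (by linarith) (le_abs_self _)
      rw [abs_div, le_div_iff₀ hαp] at h2
      linarith
    have h3 : |α| ^ dg ≤ 2 ^ dg * |G.wslope (v ++ w')| ^ dg := by
      rw [← Real.mul_rpow (by norm_num) (abs_nonneg _)]
      exact Real.rpow_le_rpow hαp.le hγ hg0
    rw [e, Real.rpow_add hαp]
    have := Real.rpow_pos_of_pos hαp dl
    nlinarith
  have hmain : (4 * (|α| * h)) ^ (dl + dg) / (|F.wslope u| ^ dl * |G.wslope v| ^ dg) ≤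
      Θ * π * μ / 2 := by
    rw [div_le_iff₀ hW, Real.mul_rpow (by norm_num) (by positivity), Real.mul_rpow hαp.le hh.le]
    have h2 : 2 * (4 ^ (dl + dg) * 2 ^ dg) * h ^ (dl + dg) ≤ μ * Θ := by
      rw [div_mul_eq_mul_div, div_le_iff₀ hΘ0] at hμ
      exact hμ
    have h4 : (0 : ℝ) < 4 ^ (dl + dg) := by positivity
    calc (4 : ℝ) ^ (dl + dg) * (|α| ^ (dl + dg) * h ^ (dl + dg))
        ≤ 4 ^ (dl + dg) *
          ((2 ^ dg * ((|F.wslope u| ^ dl * |G.wslope v| ^ dg) * π)) * h ^ (dl + dg)) := by gcongr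
      _ = 2 * (4 ^ (dl + dg) * 2 ^ dg) * h ^ (dl + dg) *
          ((|F.wslope u| ^ dl * |G.wslope v| ^ dg) * π) / 2 := by ring
      _ ≤ μ * Θ * ((|F.wslope u| ^ dl * |G.wslope v| ^ dg) * π) / 2 := by gcongr
      _ = _ := by ring
  linarith

end Content

section Directions

variable {A B : ℕ} {F : AffineIFS A} {G : AffineIFS B} {Cl Cg : Set ℝ}

/-- For almost every slope `t`, if `(x, y) ↦ x + t y` has a coincidence on the product, then the
image of the product has zero Hausdorff measure. -/
theorem ae_hausdorffMeasure_projCyl_eq_zero (hCl : F.IsAttractor Cl) (hCg : G.IsAttractor Cg)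
    {dl dg : ℝ} (hdl : F.IsSimilarityDim dl) (hdg : G.IsSimilarityDim dg) :
    ∀ᵐ t : ℝ, (∃ x ∈ Cl, ∃ x' ∈ Cl, ∃ y ∈ Cg, ∃ y' ∈ Cg, x ≠ x' ∧ y ≠ y' ∧
      x + t * y = x' + t * y') → μH[dl + dg] (projCyl F G Cl Cg t [] []) = 0 := by
  have := hCl.nonempty_index
  have := hCg.nonempty_index
  obtain ⟨c₁, ρ₁, hc₁, hρ₁, h₁⟩ := F.exists_rate_bounds
  obtain ⟨c₂, ρ₂, hc₂, hρ₂, h₂⟩ := G.exists_rate_bounds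
  let c := min c₁ c₂
  let ρ := max ρ₁ ρ₂
  have hc : 0 < c := lt_min hc₁ hc₂
  have hρ : ρ < 1 := max_lt hρ₁ hρ₂
  have hF : ∀ i, c ≤ F.rate i ∧ F.rate i ≤ ρ := fun i =>
    ⟨(min_le_left _ _).trans (h₁ i).1, (h₁ i).2.trans (le_max_left _ _)⟩
  have hG : ∀ i, c ≤ G.rate i ∧ G.rate i ≤ ρ := fun i =>
    ⟨(min_le_right _ _).trans (h₂ i).1, (h₂ i).2.trans (le_max_right _ _)⟩
  have hae := ae_all_iff.2 fun k : ℕ => ae_closePair hCl hCg hc hρ hF hG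
    (ε := 1 / ((k : ℝ) + 1)) (by positivity)
  filter_upwards [hae] with t ht hco
  have hclose : ∀ ε > 0, ClosePair F G (c ^ 2)⁻¹ ε t := by
    intro ε hε
    obtain ⟨k, hk⟩ := exists_nat_one_div_lt hε
    obtain ⟨U, V, U', V', h1, h2, h3, h4, h5, h6⟩ := ht k hco
    exact ⟨U, V, U', V', h1, h2.trans hk, h3.trans hk, h4, h5, h6.trans (by
      have := F.abs_wslope_pos U; gcongr)⟩
  have hmass := exists_projMass_ge hCl hCg hdl hdg (K := (c ^ 2)⁻¹) (by positivity) hclose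
  refine hausdorffMeasure_eq_zero_of_hausdorffContent ?_
    (hausdorffContent_projCyl_eq_zero hCl hCg hdl hdg hc hρ hF hG hmass)
  refine lt_of_le_of_ne (add_nonneg hdl.nonneg hdg.nonneg) fun hs => ?_
  obtain ⟨m, n, z, h, -, hμ⟩ := hmass 2
  rw [← hs, Real.rpow_zero] at hμ
  linarith [projMass_le_one (Cl := Cl) (Cg := Cg) hdl hdg t m n (Metric.closedBall z h)]

/-- The tangent pulls null sets back to null sets. -/
theorem ae_tan_of_ae {P : ℝ → Prop} (h : ∀ᵐ t : ℝ, P t) : ∀ᵐ θ : ℝ, P (Real.tan θ) := by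
  have hcos : ∀ᵐ θ : ℝ, Real.cos θ ≠ 0 := by
    refine Set.Countable.ae_notMem ((Set.countable_range
      fun k : ℤ => (2 * (k : ℝ) + 1) * Real.pi / 2).mono ?_) volume
    intro θ hθ
    obtain ⟨k, hk⟩ := Real.cos_eq_zero_iff.1 hθ
    exact ⟨k, hk.symm⟩
  have hnull : ∀ k : ℤ, volume ((fun t => Real.arctan t + k * Real.pi) '' {t | ¬ P t}) = 0 :=
    fun k => addHaar_image_eq_zero_of_differentiableOn_of_addHaar_eq_zero volume
      (fun t _ => ((Real.differentiableAt_arctan t).add_const _).differentiableWithinAt)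
      (ae_iff.1 h)
  have hU : ∀ᵐ θ : ℝ, θ ∉ ⋃ k : ℤ, (fun t => Real.arctan t + k * Real.pi) '' {t | ¬ P t} :=
    measure_eq_zero_iff_ae_notMem.1 (measure_iUnion_null hnull)
  filter_upwards [hcos, hU] with θ hθ hθU
  by_contra hP
  refine hθU (Set.mem_iUnion.2 ?_)
  have hφ := Real.cos_arctan_pos (Real.tan θ)
  have hsin : Real.sin (θ - Real.arctan (Real.tan θ)) = 0 := by
    have h1 := Real.tan_arctan (Real.tan θ)
    rw [Real.tan_eq_sin_div_cos (Real.arctan _), Real.tan_eq_sin_div_cos θ,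
      div_eq_div_iff (by rw [← Real.tan_eq_sin_div_cos]; exact hφ.ne') hθ,
      ← Real.tan_eq_sin_div_cos] at h1
    rw [Real.sin_sub]
    linarith
  obtain ⟨k, hk⟩ := Real.sin_eq_zero_iff.1 hsin
  exact ⟨k, Real.tan θ, hP, by simp only; linarith⟩

theorem angleProj_apply (θ : ℝ) (p : EuclideanSpace ℝ (Fin 2)) :
    angleProj θ p = (Real.cos θ * p 0 + Real.sin θ * p 1) •
      (!₂[Real.cos θ, Real.sin θ] : EuclideanSpace ℝ (Fin 2)) := by
  have hn : ‖(!₂[Real.cos θ, Real.sin θ] : EuclideanSpace ℝ (Fin 2))‖ = 1 := by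
    simp [EuclideanSpace.norm_eq]
  refine (Submodule.starProjection_unit_singleton ℝ hn p).trans ?_
  congr 1
  simp [PiLp.inner_apply, Fin.sum_univ_two, mul_comm]

end Directions

theorem mainTheorem3 {A B : ℕ} (F : AffineIFS A) (G : AffineIFS B)
    (Cl Cg : Set ℝ) (hCl : F.IsAttractor Cl) (hCg : G.IsAttractor Cg)
    (dl dg : ℝ) (hdl : F.IsSimilarityDim dl) (hdg : G.IsSimilarityDim dg) :
    ∀ᵐ θ : ℝ ∂volume, θ ∈ intersectionParams (planeProd Cl Cg) →
      μH[dl + dg] (angleProj θ '' planeProd Cl Cg) = 0 := by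
  have := hCl.nonempty_index
  have := hCg.nonempty_index
  have hne : ∀ᵐ t : ℝ, t ≠ 0 := Set.Countable.ae_notMem (Set.countable_singleton 0) volume
  filter_upwards [ae_tan_of_ae (ae_hausdorffMeasure_projCyl_eq_zero hCl hCg hdl hdg),
    ae_tan_of_ae hne] with θ hθ ht hip
  have hcos : Real.cos θ ≠ 0 := fun h => ht (by rw [Real.tan_eq_sin_div_cos, h, div_zero])
  have hlin : ∀ x y : ℝ, Real.cos θ * x + Real.sin θ * y =
      Real.cos θ * (x + Real.tan θ * y) := fun x y => by
    rw [Real.tan_eq_sin_div_cos]; field_simp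
  let e : EuclideanSpace ℝ (Fin 2) := !₂[Real.cos θ, Real.sin θ]
  have he : e ≠ 0 := fun h => hcos (by simpa [e] using congrArg (fun p => p 0) h)
  have hzero : μH[dl + dg] (projCyl F G Cl Cg (Real.tan θ) [] []) = 0 := by
    refine hθ ?_
    simp only [intersectionParams, Set.InjOn, Set.mem_ofPred_eq] at hip
    push Not at hip
    obtain ⟨p, hp, q, hq, hpq, hne⟩ := hip
    rw [angleProj_apply, angleProj_apply, hlin, hlin] at hpq
    have hpq := mul_left_cancel₀ hcos (smul_left_injective ℝ he hpq)
    have hdiff : p 0 ≠ q 0 ∨ p 1 ≠ q 1 := by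
      by_contra! h
      refine hne (PiLp.ext fun i => ?_)
      fin_cases i
      · exact h.1
      · exact h.2
    have h01 : p 0 = q 0 ↔ p 1 = q 1 := by
      constructor
      · intro h; rw [h] at hpq; exact mul_left_cancel₀ ht (add_left_cancel hpq)
      · intro h; rw [h] at hpq; exact add_right_cancel hpq
    exact ⟨p 0, hp.1, q 0, hq.1, p 1, hp.2, q 1, hq.2, by tauto, by tauto, hpq⟩
  have hsub : angleProj θ '' planeProd Cl Cg ⊆
      (ContinuousLinearMap.toSpanSingleton ℝ (Real.cos θ • e)) ''
        projCyl F G Cl Cg (Real.tan θ) [] [] := by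
    rintro _ ⟨p, hp, rfl⟩
    refine ⟨p 0 + Real.tan θ * p 1, ⟨p 0, hp.1, p 1, hp.2, ?_⟩, ?_⟩
    · rw [AffineIFS.wmap_nil, AffineIFS.wmap_nil]
    · rw [ContinuousLinearMap.toSpanSingleton_apply, angleProj_apply, hlin, smul_smul, mul_comm]
  refine measure_mono_null hsub (le_antisymm ?_ (by simp))
  refine ((ContinuousLinearMap.lipschitz _).hausdorffMeasure_image_le
    (add_nonneg hdl.nonneg hdg.nonneg) _).trans ?_
  rw [hzero, mul_zero]
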